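/- All graphs are finite and simple, and $\rho(G)$ denotes the largest eigenvalue of the adjacency matrix of $G$. For a graph $F$, let $\mathrm{spex}(n,F)$ be the maximum of $\rho(G)$ over all graphs $G$ of order $n$ that contain no copy of $F$ as a (not necessarily induced) subgraph, and let $\mathrm{SPEX}(n,F)$ be the family of all such graphs with $\rho(G)=\mathrm{spex}(n,F)$; graphs are considered up to isomorphism. For $n>k>0$ and $0\le p\le\lfloor (n-k)/2\rfloor$, let $S_{n,k}^{p}$ be the graph obtained from the join of $K_k$ and $n-k$ isolated vertices by adding $p$ pairwise disjoint edges among these $n-k$ vertices. Put $G_{n,\ell}=S_{n,(\ell-2)/2}^{0}$ if $\ell$ is even and $G_{n,\ell}=S_{n,(\ell-3)/2}^{1}$ if $\ell$ is odd. Let $\ell\ge 6$ and $4\le d\le \ell-1$ be integers. There is an $N=N(\ell,d)$ such that the following hold. (i) If at least one of $\ell$ and $d$ is even, then there exists a tree $F$ of order $\ell$ and diameter $d$ such that $\mathrm{SPEX}(n,F)=\{G_{n,\ell}\}$ for all $n\ge N$. (ii) If both $\ell$ and $d$ are odd, $n\ge N$, and $G$ is a graph of order $n$ with $\rho(G)\ge\rho(S_{n,(\ell-3)/2}^{0})$,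 then $G$ contains all trees of order $\ell$ and diameter $d$ if and only if $G\ne S_{n,(\ell-3)/2}^{0}$; that is, $G$ contains all of them unless $G=S_{n,(\ell-3)/2}^{0}$, and this graph is a genuine exception. -/

import Mathlib

open scoped SimpleGraph

noncomputable section

open scoped Classical in
/-- The spectral radius `ρ(G)`: the largest eigenvalue of the (real symmetric) adjacency matrix
of a finite graph. -/
def graphRho {V : Type*} [Fintype V] (G : SimpleGraph V) : ℝ :=
  sSup (spectrum ℝ (G.adjMatrix ℝ))

/-- `spex(n, F)`: the maximum of `ρ(G)` over all `F`-free graphs `G` of order `n`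
(a supremum over a finite set). -/
def spex {W : Type*} (n : ℕ) (F : SimpleGraph W) : ℝ :=
  sSup {r : ℝ | ∃ G : SimpleGraph (Fin n), F.Free G ∧ graphRho G = r}

/-- `SPEX(n, F)`: the `F`-free graphs of order `n` whose spectral radius is `spex(n, F)`. -/
def SPEX {W : Type*} (n : ℕ) (F : SimpleGraph W) : Set (SimpleGraph (Fin n)) :=
  {G | F.Free G ∧ graphRho G = spex n F}

/-- `S_{n,k}^p`: the join of the complete graph on the vertices `0, …, k-1` with the empty graph
on `k, …, n-1`, together with the `p` independent edges `{k+2t, k+2t+1}`, `t < p`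
(meant for `0 < k < n` and `2 * p ≤ n - k`). -/
def graphS (n k p : ℕ) : SimpleGraph (Fin n) where
  Adj i j := i ≠ j ∧ ((i : ℕ) < k ∨ (j : ℕ) < k ∨
    ∃ t < p, ((i : ℕ) = k + 2 * t ∧ (j : ℕ) = k + 2 * t + 1) ∨
      ((j : ℕ) = k + 2 * t ∧ (i : ℕ) = k + 2 * t + 1))
  symm := ⟨by
    rintro i j ⟨hne, h⟩
    refine ⟨hne.symm, ?_⟩
    rcases h with h | h | ⟨t, ht, h⟩
    · exact Or.inr (Or.inl h)
    · exact Or.inl h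
    · exact Or.inr (Or.inr ⟨t, ht, h.symm⟩)⟩
  loopless := ⟨fun _ h => h.1 rfl⟩

/-- `G_{n,ℓ}`: `S_{n,(ℓ-2)/2}^0` for even `ℓ` and `S_{n,(ℓ-3)/2}^1` for odd `ℓ`. -/
def graphGnl (n l : ℕ) : SimpleGraph (Fin n) :=
  if Even l then graphS n ((l - 2) / 2) 0 else graphS n ((l - 3) / 2) 1

end

/-! Let `F` be a tree of order at most `2k + 3` and diameter at least `3`, and let `G` be an
`F`-free graph of large order `n` with `ρ(G) ≥ ρ(S_{n,k}^0)`. Greedy embedding shows that `G` has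
`O(n)` edges, which leaves few vertices with a large entry in the Perron vector of `G`. As `F`
embeds in the complete bipartite graph with `k + 1` and many vertices, counting walks of length two
from these vertices shows that exactly `k` of them have an entry close to the maximum and that each
of these `k` is adjacent to almost all vertices. Completing them to a join `S_{n,k}^0` adds more to
the spectral radius than the remaining edges of `G` contribute, so that nothing is missing and `G`
contains `S_{n,k}^0`. Two further edges would already create a copy of `F`; hence `G` is `S_{n,k}^0`
or `S_{n,k}^1`.

The second graph contains all such trees of order at most `2k + 2`, and those of order `2k + 3`
with odd diameter: the ends of a longest path then are leaves of both colours, so that the extra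
edge can serve as the pendant edge at a leaf of the smaller colour class. Conversely, the vertices
that a copy of `F` in `S_{n,k}^0` places in `K_k` form a vertex cover of `F`. The spider with one
leg of length `d - 2` and all other legs of length two (or one, for the last) has no cover that
small: for even `ℓ` or odd `d` because of a matching, and for odd `ℓ` and even `d` not even one of
size `k + 1` that contains an end of the edge of `S_{n,k}^1` outside the join. -/

section SpectralTrees

open Finset
open scoped Classical

section NbrSum

variable {V : Type*} {G : SimpleGraph V} {x y : V → ℝ} {S : Finset V} {v : V} {c : ℝ}

variable (G x S v) in
/-- The sum of `x` over the neighbours of `v` that lie in `S`: the `v`-th entry of the product of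
the adjacency matrix with the restriction of `x` to `S`. For `x = 1` it is the number of these
neighbours. -/
noncomputable def nbrSum : ℝ := ∑ u ∈ S with G.Adj v u, x u

theorem nbrSum_eq_sum_ite : nbrSum G x S v = ∑ u ∈ S, if G.Adj v u then x u else 0 :=
  sum_filter _ _

theorem nbrSum_one : nbrSum G 1 S v = #{u ∈ S | G.Adj v u} := by
  simp [nbrSum]

theorem nbrSum_nonneg (hx : ∀ u ∈ S, 0 ≤ x u) : 0 ≤ nbrSum G x S v :=
  sum_nonneg fun u hu => hx u (mem_filter.1 hu).1

theorem nbrSum_le_card_mul (hx : ∀ u ∈ S, x u ≤ c) : nbrSum G x S v ≤ #{u ∈ S | G.Adj v u} * c := by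
  simpa [nbrSum] using sum_le_card_nsmul _ _ c fun u hu => hx u (mem_filter.1 hu).1

theorem nbrSum_le_sum (hx : ∀ u ∈ S, 0 ≤ x u) : nbrSum G x S v ≤ ∑ u ∈ S, x u :=
  sum_le_sum_of_subset_of_nonneg (filter_subset _ _) fun u hu _ => hx u hu

theorem nbrSum_erase_add (hv : v ∈ S) (w : V) :
    nbrSum G x (S.erase v) w + (if G.Adj w v then x v else 0) = nbrSum G x S w := by
  rw [nbrSum_eq_sum_ite, nbrSum_eq_sum_ite, sum_erase_add _ _ hv]

theorem sum_mul_nbrSum_comm (A B : Finset V) :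
    ∑ u ∈ A, y u * nbrSum G x B u = ∑ v ∈ B, x v * nbrSum G y A v := by
  simp_rw [nbrSum_eq_sum_ite, mul_sum, mul_ite, mul_zero]
  rw [sum_comm]
  simp_rw [G.adj_comm, mul_comm]

theorem nbrSum_mono (h : ∀ u ∈ S, x u ≤ y u) : nbrSum G x S v ≤ nbrSum G y S v :=
  sum_le_sum fun u hu => h u (mem_filter.1 hu).1

theorem nbrSum_add_nbrSum_compl [Fintype V] :
    nbrSum G x S v + nbrSum G x Sᶜ v = nbrSum G x univ v := by
  simp only [nbrSum_eq_sum_ite, sum_add_sum_compl]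

theorem nbrSum_union {A B : Finset V} (h : Disjoint A B) :
    nbrSum G x (A ∪ B) v = nbrSum G x A v + nbrSum G x B v := by
  simp only [nbrSum_eq_sum_ite, sum_union h]

theorem sum_mul_nbrSum_union {A B : Finset V} (h : Disjoint A B) :
    ∑ u ∈ A ∪ B, x u * nbrSum G x (A ∪ B) u =
      ∑ u ∈ A, x u * nbrSum G x A u + 2 * ∑ u ∈ A, x u * nbrSum G x B u +
        ∑ u ∈ B, x u * nbrSum G x B u := by
  simp only [sum_union h, nbrSum_union h, mul_add, sum_add_distrib]
  rw [sum_mul_nbrSum_comm B A]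
  ring

theorem nbrSum_add_sum_le {T : Finset V} (hx : ∀ u ∈ S, 0 ≤ x u) (hT : T ⊆ S)
    (hv : ∀ u ∈ T, ¬ G.Adj v u) : nbrSum G x S v + ∑ u ∈ T, x u ≤ ∑ u ∈ S, x u := by
  have hdisj : Disjoint {u ∈ S | G.Adj v u} T :=
    disjoint_left.2 fun u hu huT => hv u huT (mem_filter.1 hu).2
  rw [nbrSum, ← sum_union hdisj]
  exact sum_le_sum_of_subset_of_nonneg (union_subset (filter_subset _ _) hT) fun u hu _ => hx u hu

end NbrSum

section Greedy

variable {V W : Type*} {G : SimpleGraph V} {F : SimpleGraph W}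

theorem exists_copy_extending_leaf {u u' : W} (hu : ∀ w, F.Adj u w → w = u') (hne : u' ≠ u)
    (f : SimpleGraph.Copy (F.induce ({u}ᶜ : Set W)) G) {v : V} (hv : G.Adj (f ⟨u', hne⟩) v)
    (hvf : ∀ w, f w ≠ v) :
    ∃ g : SimpleGraph.Copy F G, g u = v ∧ ∀ w (hw : w ≠ u), g w = f ⟨w, hw⟩ := by
  let g : W → V := fun w => if hw : w = u then v else f ⟨w, hw⟩
  have hgu : g u = v := dif_pos rfl
  have hg : ∀ w (hw : w ≠ u), g w = f ⟨w, hw⟩ := fun w hw => dif_neg hw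
  have hadj : ∀ ⦃a b⦄, F.Adj a b → G.Adj (g a) (g b) := by
    intro a b hab
    rcases eq_or_ne a u with rfl | ha
    · obtain rfl := hu b hab
      rwa [hgu, hg _ hne, G.adj_comm]
    rcases eq_or_ne b u with rfl | hb
    · obtain rfl := hu a hab.symm
      rwa [hgu, hg _ hne]
    rw [hg a ha, hg b hb]
    exact f.toHom.map_adj (SimpleGraph.induce_adj.2 hab)
  have hinj : Function.Injective g := by
    intro a b hab
    by_cases ha : a = u <;> by_cases hb : b = u
    · rw [ha, hb]
    · rw [ha, hgu, hg b hb] at hab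
      exact absurd hab.symm (hvf _)
    · rw [hb, hgu, hg a ha] at hab
      exact absurd hab (hvf _)
    · rw [hg a ha, hg b hb] at hab
      exact congrArg Subtype.val (f.injective hab)
  exact ⟨⟨⟨g, fun {a b} => @hadj a b⟩, hinj⟩, hgu, hg⟩

theorem exists_mem_ne_of_card_le [Fintype W] {S : W → Finset V} {u : W} (hu : (S u).Nonempty)
    {N : Finset V} (hN : N ⊆ S u) (hcard : #{w | ¬ Disjoint (S w) (S u)} ≤ #N)
    {f : ({u}ᶜ : Set W) → V} (hf : ∀ w, f w ∈ S w.1) : ∃ v ∈ N, ∀ w, f w ≠ v := by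
  by_contra! hcov
  let T : Finset ({u}ᶜ : Set W) := {w | ¬ Disjoint (S w.1) (S u)}
  have hNT : N ⊆ T.image f := by
    intro v hv
    obtain ⟨w, rfl⟩ := hcov v hv
    exact mem_image_of_mem f (mem_filter.2 ⟨mem_univ _, not_disjoint_iff.2 ⟨_, hf w, hN hv⟩⟩)
  have hTu : T.map (Function.Embedding.subtype _) ⊂ ({w | ¬ Disjoint (S w) (S u)} : Finset W) := by
    refine (ssubset_iff_of_subset ?_).2 ⟨u, ?_, ?_⟩
    · intro w hw
      obtain ⟨w, hwT, rfl⟩ := mem_map.1 hw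
      exact mem_filter.2 ⟨mem_univ w.1, (mem_filter.1 hwT).2⟩
    · simpa [nonempty_iff_ne_empty] using hu
    · simp
  have := ((card_le_card hNT).trans card_image_le).trans_lt ((card_map _).symm.trans_lt
    (card_lt_card hTu))
  omega

/-- Remove a leaf `u`, embed the rest, and place `u`: the vertices already used that are allowed
for `u` are images of other `w` with `S w` meeting `S u`, so they cannot exhaust the allowed
neighbours. -/
theorem exists_copy_of_allowed [Fintype W] (hF : F.IsTree) (S : W → Finset V)
    (hS : ∀ w, (S w).Nonempty)
    (hdeg : ∀ w w', F.Adj w w' → ∀ v ∈ S w,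
      #{w'' | ¬ Disjoint (S w'') (S w')} ≤ #{u ∈ S w' | G.Adj v u}) :
    ∃ f : SimpleGraph.Copy F G, ∀ w, f w ∈ S w := by
  induction hm : Fintype.card W generalizing W with
  | zero =>
    have := hF.connected.nonempty
    exact absurd hm Fintype.card_ne_zero
  | succ m ih =>
    rcases subsingleton_or_nontrivial W with _ | _
    · choose f hf using hS
      exact ⟨⟨⟨f, fun h => absurd (Subsingleton.elim _ _) h.ne⟩,
        Function.injective_of_subsingleton f⟩, hf⟩
    obtain ⟨u, hu⟩ := hF.exists_vert_degree_one_of_nontrivial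
    obtain ⟨u', huu', hu'⟩ := SimpleGraph.degree_eq_one_iff_existsUnique_adj.1 hu
    have hcard : ∀ w : ({u}ᶜ : Set W),
        #{w'' : ({u}ᶜ : Set W) | ¬ Disjoint (S w'') (S w)} ≤ #{w'' | ¬ Disjoint (S w'') (S w)} :=
      fun w => card_le_card_of_injOn Subtype.val (fun a ha => by simpa using ha)
        Subtype.val_injective.injOn
    obtain ⟨f, hf⟩ := ih (F := F.induce ({u}ᶜ : Set W))
      ⟨hF.connected.induce_compl_singleton_of_degree_eq_one hu, hF.isAcyclic.induce _⟩
      (fun w => S w) (fun w => hS w) (fun w w' h v hv => (hcard w').trans (hdeg w w' h v hv))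
      (by rw [Fintype.card_compl_set, hm, Set.card_singleton, Nat.add_sub_cancel])
    obtain ⟨v, hv, hvf⟩ := exists_mem_ne_of_card_le (hS u) (filter_subset _ _)
      (hdeg u' u huu'.symm _ (hf ⟨u', huu'.ne'⟩)) hf
    obtain ⟨g, hgu, hg⟩ := exists_copy_extending_leaf hu' huu'.ne' f (mem_filter.1 hv).2 hvf
    refine ⟨g, fun w => ?_⟩
    rcases eq_or_ne w u with rfl | hw
    · exact hgu ▸ (mem_filter.1 hv).1
    · exact hg w hw ▸ hf ⟨w, hw⟩

end Greedy

section ColorClass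

variable {W : Type*} {F : SimpleGraph W} {A : Finset W}

variable (F A) in
/-- `A` is one of the two colour classes of a proper 2-colouring of `F`: every edge of `F` has
exactly one end in `A`. -/
def IsColorClass : Prop := ∀ ⦃w w'⦄, F.Adj w w' → (w ∈ A ↔ w' ∉ A)

theorem IsColorClass.compl [Fintype W] (hA : IsColorClass F A) : IsColorClass F Aᶜ :=
  fun w w' h => by simpa only [mem_compl, not_not] using not_congr (hA h)

theorem IsColorClass.subset_notMem (hA : IsColorClass F A) {C : Finset W} (hC : C ⊆ A) :
    ∀ ⦃w w'⦄, F.Adj w w' → w ∈ C → w' ∉ C :=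
  fun _ _ h hw hw' => (hA h).1 (hC hw) (hC hw')

theorem isColorClass_even_dist [Fintype W] (hF : F.IsTree) (r : W) :
    IsColorClass F {v | Even (F.dist r v)} := by
  intro w w' h
  simp only [mem_filter, mem_univ, true_and]
  rcases hF.dist_eq_dist_add_one_of_adj r h with h | h <;> rw [h, Nat.even_add_one]
  exact not_not.symm

theorem exists_isColorClass [Fintype W] (hF : F.IsTree) (X : Finset W) :
    ∃ A, IsColorClass F A ∧ 2 * #(A \ X) + #X ≤ Fintype.card W := by
  obtain ⟨r⟩ := hF.connected.nonempty
  have hA := isColorClass_even_dist hF r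
  set A : Finset W := {v | Even (F.dist r v)}
  have hsum : #(A \ X) + #(Aᶜ \ X) + #X = Fintype.card W := by
    have hX : Aᶜ \ X = Xᶜ \ A := by ext; simp [and_comm]
    have hA : A \ X = Xᶜ ∩ A := by ext; simp [and_comm]
    rw [hX, hA, card_inter_add_card_sdiff, card_compl_add_card]
  rcases le_total #(A \ X) #(Aᶜ \ X) with h | h
  · exact ⟨A, hA, by omega⟩
  · exact ⟨Aᶜ, hA.compl, by omega⟩

end ColorClass

section Leaves

variable {W : Type*} {F : SimpleGraph W}

theorem existsUnique_adj_of_dist_eq_diam (hF : F.IsTree) {u v : W}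
    (huv : F.dist u v = F.diam) (hd : F.diam ≠ 0) : ∃! w, F.Adj v w := by
  have hdist : ∀ w, F.Adj v w → F.dist u v = F.dist u w + 1 := by
    intro w hw
    have := SimpleGraph.dist_le_diam (SimpleGraph.ediam_ne_top_of_diam_ne_zero hd) (u := u) (v := w)
    rcases hF.dist_eq_dist_add_one_of_adj u hw with h | h <;> omega
  have hpath : ∀ w, F.Adj v w → ∃ p : F.Walk u v, p.IsPath ∧ p.penultimate = w := by
    intro w hw
    obtain ⟨p, hp⟩ := hF.connected.exists_walk_length_eq_dist u w
    refine ⟨p.concat hw.symm, SimpleGraph.Walk.isPath_of_length_eq_dist _ ?_, by simp⟩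
    rw [SimpleGraph.Walk.length_concat, hp, hdist w hw]
  have : Nontrivial W := ⟨u, v, by rintro rfl; exact hd (huv.symm.trans SimpleGraph.dist_self)⟩
  obtain ⟨w, hw⟩ := hF.connected.preconnected.exists_adj_of_nontrivial v
  refine ⟨w, hw, fun w' hw' => ?_⟩
  obtain ⟨p, hp, rfl⟩ := hpath w hw
  obtain ⟨q, hq, rfl⟩ := hpath w' hw'
  rw [(hF.existsUnique_path u v).unique hp hq]

theorem exists_two_leaves (hF : F.IsTree) (hd : 3 ≤ F.diam) :
    ∃ x y x' y' : W, (∀ w, F.Adj x w ↔ w = y) ∧ (∀ w, F.Adj x' w ↔ w = y') ∧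
      x ≠ x' ∧ y ≠ y' ∧ x ≠ y' ∧ x' ≠ y := by
  have := hF.connected.nonempty
  obtain ⟨u, v, huv⟩ := F.exists_dist_eq_diam
  obtain ⟨y', hy', hv⟩ := existsUnique_adj_of_dist_eq_diam hF huv (by omega)
  obtain ⟨y, hy, hu⟩ := existsUnique_adj_of_dist_eq_diam hF
    (F.dist_comm.trans huv) (by omega)
  have huy : F.dist u y = 1 := SimpleGraph.dist_eq_one_iff_adj.2 hy
  have hvy' : F.dist y' v = 1 := SimpleGraph.dist_eq_one_iff_adj.2 hy'.symm
  have huyv := hF.connected.dist_triangle (u := u) (v := y) (w := v)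
  have huy'v := hF.connected.dist_triangle (u := u) (v := y') (w := v)
  refine ⟨u, y, v, y', fun w => ⟨hu w, fun h => h ▸ hy⟩, fun w => ⟨hv w, fun h => h ▸ hy'⟩,
    ?_, ?_, ?_, ?_⟩
  · rintro rfl; simp at huv; omega
  · rintro rfl; omega
  · rintro rfl; omega
  · rintro rfl; omega

end Leaves

section Sparse

variable {V W : Type*} [Fintype W] {G : SimpleGraph V} {F : SimpleGraph W}

theorem exists_mem_card_adj_lt (hF : F.IsTree) (hG : F.Free G) {S : Finset V} (hS : S.Nonempty) :
    ∃ v ∈ S, #{u ∈ S | G.Adj v u} < Fintype.card W := by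
  by_contra! hcon
  exact hG (exists_copy_of_allowed hF (fun _ => S) (fun _ => hS)
    fun _ _ _ v hv => (card_le_univ _).trans (hcon v hv)).nonempty

theorem sum_mul_nbrSum_erase_add {S : Finset V} {v : V} (hv : v ∈ S) (x : V → ℝ) :
    ∑ u ∈ S.erase v, x u * nbrSum G x (S.erase v) u + 2 * (x v * nbrSum G x S v) =
      ∑ u ∈ S, x u * nbrSum G x S u := by
  have hrow : ∑ u ∈ S.erase v, x u * nbrSum G x S u =
      ∑ u ∈ S.erase v, x u * nbrSum G x (S.erase v) u + x v * nbrSum G x S v := by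
    simp_rw [← nbrSum_erase_add hv, mul_add, sum_add_distrib, SimpleGraph.irrefl, if_false,
      mul_zero, add_zero]
    simp_rw [nbrSum_eq_sum_ite, mul_sum, mul_ite, mul_zero, G.adj_comm v, mul_comm]
  rw [← sum_erase_add _ _ hv, hrow]
  ring

theorem sum_mul_nbrSum_le (hF : F.IsTree) (hG : F.Free G) {x : V → ℝ} {η : ℝ} (S : Finset V)
    (hx0 : ∀ v ∈ S, 0 ≤ x v) (hxη : ∀ v ∈ S, x v ≤ η) :
    ∑ u ∈ S, x u * nbrSum G x S u ≤ 2 * Fintype.card W * η * ∑ u ∈ S, x u := by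
  induction hn : #S generalizing S with
  | zero => simp [card_eq_zero.1 hn]
  | succ n ih =>
    obtain ⟨v, hv, hdeg⟩ := exists_mem_card_adj_lt hF hG (S := S) (card_pos.1 (by omega))
    have hη : 0 ≤ η := (hx0 v hv).trans (hxη v hv)
    have hrest := ih (S.erase v) (fun u hu => hx0 u (mem_of_mem_erase hu))
      (fun u hu => hxη u (mem_of_mem_erase hu)) (by have := card_erase_add_one hv; omega)
    have hrow : x v * nbrSum G x S v ≤ x v * (Fintype.card W * η) := by
      refine mul_le_mul_of_nonneg_left ((nbrSum_le_card_mul hxη).trans ?_) (hx0 v hv)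
      exact mul_le_mul_of_nonneg_right (mod_cast hdeg.le) hη
    rw [← sum_mul_nbrSum_erase_add hv, ← sum_erase_add _ _ hv]
    linarith

theorem sum_nbrSum_one_le (hF : F.IsTree) (hG : F.Free G) (S : Finset V) :
    ∑ u ∈ S, nbrSum G 1 S u ≤ 2 * Fintype.card W * #S := by
  simpa using sum_mul_nbrSum_le hF hG (x := 1) (η := 1) S (by simp) (by simp)

theorem isContained_of_isColorClass (hF : F.IsTree) {A : Finset W} (hA : IsColorClass F A)
    {k : ℕ} (hAk : #A ≤ k + 1) {P Q : Finset V} (hPQ : Disjoint P Q) (hne : (P ∪ Q).Nonempty)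
    (hP : ∀ p ∈ P, Fintype.card W < #{q ∈ Q | G.Adj p q})
    (hQ : ∀ q ∈ Q, k < #{p ∈ P | G.Adj q p}) : F ⊑ G := by
  have hPne : P.Nonempty := by
    obtain ⟨v, hv⟩ := hne
    rcases mem_union.1 hv with hv | hv
    · exact ⟨v, hv⟩
    · exact (card_pos.1 (hQ v hv).pos).mono (filter_subset _ _)
  have hQne : Q.Nonempty := by
    obtain ⟨p, hp⟩ := hPne
    exact (card_pos.1 ((Nat.zero_le _).trans_lt (hP p hp))).mono (filter_subset _ _)
  refine (exists_copy_of_allowed hF (fun w => if w ∈ A then P else Q)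
    (fun w => by split_ifs <;> assumption) ?_).nonempty
  intro w w' h v hv
  by_cases hw : w ∈ A
  · simp only [hw, (hA h).1 hw, if_true, if_false] at hv ⊢
    exact (card_le_univ _).trans (hP v hv).le
  · have hw' : w' ∈ A := (hA h.symm).2 hw
    simp only [hw, hw', if_true, if_false] at hv ⊢
    refine (card_le_card fun w'' h'' => ?_).trans (hAk.trans (hQ v hv))
    by_contra hcon
    simp [hcon, hPQ.symm] at h''

theorem sum_card_adj_between_le (hF : F.IsTree) (hG : F.Free G) {A : Finset W} {k : ℕ}
    (hA : IsColorClass F A) (hAk : #A ≤ k + 1) (P Q : Finset V) (hPQ : Disjoint P Q) :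
    ∑ q ∈ Q, #{p ∈ P | G.Adj q p} ≤ k * #Q + Fintype.card W * #P := by
  induction hn : #P + #Q generalizing P Q with
  | zero => simp [card_eq_zero.1 (show #Q = 0 by omega)]
  | succ n ih =>
    by_cases! hq : ∃ q ∈ Q, #{p ∈ P | G.Adj q p} ≤ k
    · obtain ⟨q, hq, hqk⟩ := hq
      have := ih P (Q.erase q) (hPQ.mono_right (erase_subset _ _))
        (by have := card_erase_add_one hq; omega)
      rw [← add_sum_erase Q _ hq, ← card_erase_add_one hq]
      linarith
    by_cases! hp : ∃ p ∈ P, #{q ∈ Q | G.Adj p q} ≤ Fintype.card W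
    · obtain ⟨p, hp, hpk⟩ := hp
      have hrest := ih (P.erase p) Q (hPQ.mono_left (erase_subset _ _))
        (by have := card_erase_add_one hp; omega)
      have hsplit : ∑ q ∈ Q, #{p ∈ P | G.Adj q p} =
          ∑ q ∈ Q, #{p ∈ P.erase p | G.Adj q p} + #{q ∈ Q | G.Adj p q} := by
        simp_rw [card_filter, ← sum_add_distrib, ← sum_erase_add P _ hp, G.adj_comm p]
      rw [hsplit, ← card_erase_add_one hp]
      linarith
    refine absurd (isContained_of_isColorClass hF hA hAk hPQ ?_ hp hq) hG
    rw [← card_pos, card_union_of_disjoint hPQ]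
    omega

end Sparse

section Embeddings

variable {V W : Type*} [Fintype W] {G : SimpleGraph V} {F : SimpleGraph W} {K R : Finset V}

theorem exists_injective_extension {X : Finset W} {g : W → V} (hg : Set.InjOn g X)
    (hR : 2 * Fintype.card W ≤ #R) :
    ∃ φ : W → V, φ.Injective ∧ Set.EqOn φ g X ∧ ∀ w ∉ X, φ w ∈ R := by
  have hcard : Fintype.card W ≤ Fintype.card ↥(R \ X.image g) := by
    have := le_card_sdiff (X.image g) R
    have : #(X.image g) ≤ Fintype.card W := card_image_le.trans (card_le_univ _)
    rw [Fintype.card_coe]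
    omega
  obtain ⟨h⟩ := Function.Embedding.nonempty_of_card_le hcard
  refine ⟨fun w => if w ∈ X then g w else h w, ?_, fun w hw => if_pos hw, fun w hw => ?_⟩
  · have hh : ∀ w, ∀ w' ∈ X, (h w : V) ≠ g w' := fun w w' hw' heq =>
      (mem_sdiff.1 (h w).2).2 (heq ▸ mem_image_of_mem g hw')
    intro w w' heq
    dsimp only at heq
    split_ifs at heq with hw hw' hw'
    · exact hg hw hw' heq
    · exact absurd heq.symm (hh _ _ hw)
    · exact absurd heq (hh _ _ hw')
    · exact h.injective (Subtype.ext heq)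
  · simpa only [if_neg hw] using (mem_sdiff.1 (h w).2).1

theorem isContained_of_injOn_compl (hKR : G.IsCompleteBetween K R) {C : Finset W}
    (hCK : #C ≤ #K) (hC : ∀ ⦃w w'⦄, F.Adj w w' → w ∈ C → w' ∉ C) {φ : W → V}
    (hφ : Set.InjOn φ (Cᶜ : Finset W)) (hφK : ∀ w ∉ C, φ w ∉ K)
    (hφR : ∀ ⦃w w'⦄, F.Adj w w' → w ∈ C → φ w' ∈ R)
    (hφadj : ∀ ⦃w w'⦄, F.Adj w w' → w ∉ C → w' ∉ C → G.Adj (φ w) (φ w')) : F ⊑ G := by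
  obtain ⟨ι⟩ : Nonempty (C ↪ K) := Function.Embedding.nonempty_of_card_le (by simpa using hCK)
  let f : W → V := fun w => if hw : w ∈ C then ι ⟨w, hw⟩ else φ w
  have hfC : ∀ w (hw : w ∈ C), f w = ι ⟨w, hw⟩ := fun w hw => dif_pos hw
  have hf : ∀ w ∉ C, f w = φ w := fun w hw => dif_neg hw
  have hfK : ∀ w ∈ C, f w ∈ K := fun w hw => hfC w hw ▸ (ι ⟨w, hw⟩).2
  refine ⟨⟨⟨f, fun {w w'} h => ?_⟩, fun w w' heq => ?_⟩⟩
  · by_cases hw : w ∈ C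
    · exact hf w' (hC h hw) ▸ hKR (hfK w hw) (hφR h hw)
    by_cases hw' : w' ∈ C
    · exact hf w hw ▸ (hKR (hfK w' hw') (hφR h.symm hw')).symm
    · exact hf w hw ▸ hf w' hw' ▸ hφadj h hw hw'
  · change f w = f w' at heq
    by_cases hw : w ∈ C <;> by_cases hw' : w' ∈ C
    · rw [hfC w hw, hfC w' hw'] at heq
      exact congrArg Subtype.val (ι.injective (Subtype.ext heq))
    · exact absurd (heq ▸ hfK w hw) (hf w' hw' ▸ hφK w' hw')
    · exact absurd (heq ▸ hfK w' hw') (hf w hw ▸ hφK w hw)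
    · rw [hf w hw, hf w' hw'] at heq
      exact hφ (by simpa using hw) (by simpa using hw') heq

/-- A copy of `F` in which the independent set `C` goes to `K`, the edges missing `C` are placed
by hand through `g`, and everything else goes to `R`. -/
theorem isContained_of_partial_map (hKR : G.IsCompleteBetween K R)
    (hR : 2 * Fintype.card W ≤ #R) {C X : Finset W} (hCK : #C ≤ #K)
    (hC : ∀ ⦃w w'⦄, F.Adj w w' → w ∈ C → w' ∉ C) {g : W → V} (hg : Set.InjOn g X)
    (hgK : ∀ w ∈ X, g w ∉ K) (hgR : ∀ ⦃w w'⦄, F.Adj w w' → w ∈ C → w' ∈ X → g w' ∈ R)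
    (hX : ∀ ⦃w w'⦄, F.Adj w w' → w ∉ C → w' ∉ C → w ∈ X ∧ w' ∈ X ∧ G.Adj (g w) (g w')) :
    F ⊑ G := by
  obtain ⟨φ, hφ, hφX, hφR⟩ := exists_injective_extension hg hR
  have hRK : ∀ r ∈ R, r ∉ K := fun r hr => Set.disjoint_right.1 hKR.disjoint hr
  refine isContained_of_injOn_compl hKR hCK hC (φ := φ) hφ.injOn ?_ ?_ ?_
  · intro w _
    by_cases hwX : w ∈ X
    · exact hφX hwX ▸ hgK w hwX
    · exact hRK _ (hφR w hwX)
  · intro w w' h hw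
    by_cases hwX : w' ∈ X
    · exact hφX hwX ▸ hgR h hw hwX
    · exact hφR w' hwX
  · intro w w' h hw hw'
    obtain ⟨hwX, hwX', hadj⟩ := hX h hw hw'
    rwa [hφX hwX, hφX hwX']

theorem isContained_of_complete_bipartite (hKR : G.IsCompleteBetween K R)
    (hR : Fintype.card W ≤ #R) {A : Finset W} (hA : IsColorClass F A) (hAK : #A ≤ #K) :
    F ⊑ G := by
  obtain ⟨ι⟩ : Nonempty (W ↪ R) := Function.Embedding.nonempty_of_card_le (by simpa using hR)
  exact isContained_of_injOn_compl hKR hAK (hA.subset_notMem subset_rfl) (φ := fun w => ι w)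
    (Subtype.val_injective.comp ι.injective).injOn
    (fun w _ => Set.disjoint_right.1 hKR.disjoint (ι w).2) (fun _ w _ _ => (ι w).2)
    fun _ _ h hw hw' => absurd ((hA h).2 hw') hw

theorem isContained_of_vertex (hKR : G.IsCompleteBetween K R) (hR : 2 * Fintype.card W ≤ #R)
    {A : Finset W} (hA : IsColorClass F A) {a : W} (ha : a ∈ A) (hAK : #(A.erase a) ≤ #K) {v : V}
    (hv : v ∉ K) (hdeg : F.degree a ≤ #{r ∈ R | G.Adj v r}) : F ⊑ G := by
  obtain ⟨ι⟩ : Nonempty (F.neighborFinset a ↪ ({r ∈ R | G.Adj v r} : Finset V)) :=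
    Function.Embedding.nonempty_of_card_le (by rwa [Fintype.card_coe, Fintype.card_coe])
  let g : W → V := fun w => if hw : w ∈ F.neighborFinset a then ι ⟨w, hw⟩ else v
  have hga : g a = v := dif_neg (by simp)
  have hgN : ∀ w (hw : w ∈ F.neighborFinset a), g w = ι ⟨w, hw⟩ := fun w hw => dif_pos hw
  have hgadj : ∀ w, F.Adj a w → g w ∈ R ∧ G.Adj v (g w) := fun w h => by
    rw [hgN w (by simpa using h)]
    exact mem_filter.1 (ι ⟨w, _⟩).2
  refine isContained_of_partial_map hKR hR hAK (hA.subset_notMem (erase_subset _ _)) (g := g)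
    (X := insert a (F.neighborFinset a)) ?_ ?_ ?_ ?_
  · rw [coe_insert, Set.injOn_insert (by simp)]
    refine ⟨fun w hw w' hw' heq => ?_, ?_⟩
    · rw [hgN w hw, hgN w' hw'] at heq
      exact congrArg Subtype.val (ι.injective (Subtype.ext heq))
    · rintro ⟨w, hw, heq⟩
      exact (hgadj w (by simpa using hw)).2.ne (hga ▸ heq.symm)
  · intro w hw
    rcases mem_insert.1 hw with rfl | hw
    · rwa [hga]
    · exact Set.disjoint_right.1 hKR.disjoint (hgadj w (by simpa using hw)).1
  · intro w w' h hw hw'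
    rcases mem_insert.1 hw' with rfl | hw'
    · exact absurd ha ((hA h).1 (mem_of_mem_erase hw))
    · exact (hgadj w' (by simpa using hw')).1
  · have hend : ∀ ⦃w⦄, w ∈ A → w ∉ A.erase a → w = a := fun w hwA hw => by
      by_contra hne
      exact hw (mem_erase.2 ⟨hne, hwA⟩)
    intro w w' h hw hw'
    by_cases hwA : w ∈ A
    · obtain rfl := hend hwA hw
      exact ⟨mem_insert_self _ _, mem_insert_of_mem (by simpa using h), hga ▸ (hgadj w' h).2⟩
    · obtain rfl := hend ((hA h.symm).2 hwA) hw'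
      exact ⟨mem_insert_of_mem (by simpa using h.symm), mem_insert_self _ _,
        hga ▸ (hgadj w h.symm).2.symm⟩

/-- A vertex with two neighbours in `R` suffices because a colour class of average degree less
than three contains a vertex of degree at most two. -/
theorem isContained_of_cherry (hF : F.IsTree) (hW : Fintype.card W ≤ 2 * #K + 3)
    (hKR : G.IsCompleteBetween K R) (hR : 2 * Fintype.card W ≤ #R) {v : V} (hv : v ∉ K)
    (hvR : 2 ≤ #{r ∈ R | G.Adj v r}) : F ⊑ G := by
  obtain ⟨A, hA, hcard⟩ := exists_isColorClass hF ∅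
  simp only [sdiff_empty, card_empty, add_zero] at hcard
  rcases le_or_gt #A #K with hAK | hAK
  · exact isContained_of_complete_bipartite hKR (by omega) hA hAK
  have hbip : F.IsBipartiteWith (A : Set W) ((Aᶜ : Finset W) : Set W) := by
    refine ⟨by simpa using disjoint_compl_right, fun w w' h => ?_⟩
    simp only [mem_coe, mem_compl]
    have := hA h
    tauto
  obtain ⟨a, ha, hdeg⟩ : ∃ a ∈ A, F.degree a ≤ 2 := by
    by_contra! hcon
    have hsum := card_nsmul_le_sum A (fun a => F.degree a) 3 hcon
    rw [SimpleGraph.isBipartiteWith_sum_degrees_eq_card_edges hbip, smul_eq_mul] at hsum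
    have := hF.card_edgeFinset
    omega
  exact isContained_of_vertex hKR hR hA ha (by rw [card_erase_of_mem ha]; omega) hv
    (hdeg.trans hvR)

/-- The edges that miss the independent set `A \ L` are the pendant edges at the leaves in `L`. -/
theorem isContained_of_leaves (hKR : G.IsCompleteBetween K R) (hR : 2 * Fintype.card W ≤ #R)
    {A : Finset W} (hA : IsColorClass F A) {L : Finset W} (hAK : #(A \ L) ≤ #K) {p : W → W}
    (hp : ∀ x ∈ L, ∀ w, F.Adj x w → w = p x) {g : W → V}
    (hg : Set.InjOn g (L ∪ L.image p : Finset W)) (hgR : ∀ w, g w ∈ R)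
    (hgadj : ∀ x ∈ L, G.Adj (g x) (g (p x))) : F ⊑ G := by
  have hend : ∀ ⦃w⦄, w ∈ A → w ∉ A \ L → w ∈ L := fun w hwA hw => by
    by_contra hne
    exact hw (mem_sdiff.2 ⟨hwA, hne⟩)
  refine isContained_of_partial_map hKR hR hAK (hA.subset_notMem sdiff_subset) hg
    (fun w _ => Set.disjoint_right.1 hKR.disjoint (hgR w)) (fun _ w _ _ _ => hgR w) ?_
  intro w w' h hw hw'
  by_cases hwA : w ∈ A
  · have hwL := hend hwA hw
    obtain rfl := hp w hwL w' h
    exact ⟨mem_union_left _ hwL, mem_union_right _ (mem_image_of_mem _ hwL), hgadj w hwL⟩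
  · have hwL := hend ((hA h.symm).2 hwA) hw'
    obtain rfl := hp w' hwL w h.symm
    exact ⟨mem_union_right _ (mem_image_of_mem _ hwL), mem_union_left _ hwL, (hgadj w' hwL).symm⟩

theorem isContained_of_two_edges (hF : F.IsTree) (hd : 3 ≤ F.diam)
    (hW : Fintype.card W ≤ 2 * #K + 3) (hKR : G.IsCompleteBetween K R)
    (hR : 2 * Fintype.card W ≤ #R) {a b a' b' : V} (hab : G.Adj a b) (hab' : G.Adj a' b')
    (ha : a ∈ R) (hb : b ∈ R) (ha' : a' ∈ R) (hb' : b' ∈ R)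
    (haa' : a ≠ a') (hbb' : b ≠ b') (hab'_ne : a ≠ b') (hba'_ne : b ≠ a') : F ⊑ G := by
  obtain ⟨x, y, x', y', hx, hx', hxx', hyy', hxy', hx'y⟩ := exists_two_leaves hF hd
  have hxy : x ≠ y := ((hx y).2 rfl).ne
  have hx'y' : x' ≠ y' := ((hx' y').2 rfl).ne
  obtain ⟨A, hA, hcard⟩ := exists_isColorClass hF {x, x'}
  rw [card_pair hxx'] at hcard
  have hab_ne := hab.ne
  have hab'_ne' := hab'.ne
  refine isContained_of_leaves hKR hR hA (L := {x, x'}) (by omega)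
    (p := fun w => if w = x then y else y')
    (g := fun w => if w = x then a else if w = y then b else if w = x' then a' else b')
    ?_ ?_ ?_ ?_
  · grind
  · intro w hw w' hw' heq
    dsimp only at heq
    simp only [coe_union, coe_image, coe_pair, Set.image_pair, Set.mem_union, Set.mem_insert_iff,
      Set.mem_singleton_iff] at hw hw'
    grind
  · grind
  · grind

theorem isContained_of_edge_of_leaf (hKR : G.IsCompleteBetween K R)
    (hR : 2 * Fintype.card W ≤ #R) {a b : V} (hab : G.Adj a b) (ha : a ∈ R) (hb : b ∈ R)
    {x : W} (hx : ∃! y, F.Adj x y) {A : Finset W} (hA : IsColorClass F A)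
    (hAK : #(A \ {x}) ≤ #K) : F ⊑ G := by
  obtain ⟨y, hxy, hx⟩ := hx
  refine isContained_of_leaves hKR hR hA hAK (p := fun _ => y)
    (g := fun w => if w = x then a else b) (fun x' hx' w h => ?_) ?_ (fun w => ?_) ?_
  · exact hx w (mem_singleton.1 hx' ▸ h)
  · simp [hxy.ne, hxy.ne', hab.ne]
  · split_ifs <;> assumption
  · simp [hxy.ne', hab]

theorem isContained_of_edge_of_card_le (hF : F.IsTree) (hd : 3 ≤ F.diam)
    (hW : Fintype.card W ≤ 2 * #K + 2) (hKR : G.IsCompleteBetween K R)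
    (hR : 2 * Fintype.card W ≤ #R) {a b : V} (hab : G.Adj a b) (ha : a ∈ R) (hb : b ∈ R) :
    F ⊑ G := by
  obtain ⟨x, y, -, -, hx, -⟩ := exists_two_leaves hF hd
  obtain ⟨A, hA, hcard⟩ := exists_isColorClass hF {x}
  rw [card_singleton] at hcard
  exact isContained_of_edge_of_leaf hKR hR hab ha hb ⟨y, (hx y).2 rfl, fun w => (hx w).1⟩ hA
    (by omega)

/-- The two ends of a longest path are leaves of different colours, so the smaller colour class
contains one of them. -/
theorem isContained_of_edge_of_odd_diam (hF : F.IsTree) (hd : Odd F.diam)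
    (hW : Fintype.card W ≤ 2 * #K + 3) (hKR : G.IsCompleteBetween K R)
    (hR : 2 * Fintype.card W ≤ #R) {a b : V} (hab : G.Adj a b) (ha : a ∈ R) (hb : b ∈ R) :
    F ⊑ G := by
  have := hF.connected.nonempty
  obtain ⟨u, v, huv⟩ := F.exists_dist_eq_diam
  have hA := isColorClass_even_dist hF u
  set A : Finset W := {w | Even (F.dist u w)}
  have hu : u ∈ A := by simp [A]
  have hv : v ∈ Aᶜ := by simp [A, huv, hd]
  have hcard : #A + #Aᶜ = Fintype.card W := card_add_card_compl A
  rcases le_total #A #Aᶜ with h | h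
  · refine isContained_of_edge_of_leaf hKR hR hab ha hb
      (existsUnique_adj_of_dist_eq_diam hF (F.dist_comm.trans huv) hd.pos.ne') hA ?_
    rw [sdiff_singleton_eq_erase, card_erase_of_mem hu]
    omega
  · refine isContained_of_edge_of_leaf hKR hR hab ha hb
      (existsUnique_adj_of_dist_eq_diam hF huv hd.pos.ne') hA.compl ?_
    rw [sdiff_singleton_eq_erase, card_erase_of_mem hv]
    omega

theorem card_adj_le_one_of_free (hF : F.IsTree) (hG : F.Free G)
    (hW : Fintype.card W ≤ 2 * #K + 3) (hKR : G.IsCompleteBetween K R)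
    (hR : 2 * Fintype.card W ≤ #R) {v : V} (hv : v ∉ K) : #{r ∈ R | G.Adj v r} ≤ 1 := by
  by_contra! h
  exact hG (isContained_of_cherry hF hW hKR hR hv h)

theorem edge_unique_of_free (hF : F.IsTree) (hd : 3 ≤ F.diam) (hG : F.Free G)
    (hW : Fintype.card W ≤ 2 * #K + 3) (hKR : G.IsCompleteBetween K R)
    (hR : 2 * Fintype.card W ≤ #R) {a b a' b' : V} (hab : G.Adj a b) (hab' : G.Adj a' b')
    (ha : a ∈ R) (hb : b ∈ R) (ha' : a' ∈ R) (hb' : b' ∈ R) :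
    a' = a ∧ b' = b ∨ a' = b ∧ b' = a := by
  have hunique : ∀ v ∈ R, ∀ r ∈ R, ∀ r' ∈ R, G.Adj v r → G.Adj v r' → r' = r := by
    intro v hv r hr r' hr' h h'
    exact card_le_one.1 (card_adj_le_one_of_free hF hG hW hKR hR
      (Set.disjoint_right.1 hKR.disjoint hv)) r' (by simp [*]) r (by simp [*])
  by_cases! haa' : a' = a
  · subst haa'
    exact Or.inl ⟨rfl, hunique a' ha b hb b' hb' hab hab'⟩
  by_cases! hba' : a' = b
  · subst hba'
    exact Or.inr ⟨rfl, hunique a' hb a ha b' hb' hab.symm hab'⟩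
  by_cases! hbb' : b' = b
  · subst hbb'
    exact absurd (hunique b' hb a ha a' ha' hab.symm hab'.symm) haa'
  by_cases! hab'_ne : b' = a
  · subst hab'_ne
    exact absurd (hunique b' ha b hb a' ha' hab hab'.symm) hba'
  exact absurd (isContained_of_two_edges hF hd hW hKR hR hab hab' ha hb ha' hb' haa'.symm hbb'.symm
    hab'_ne.symm hba'.symm) hG

end Embeddings

section Spectral

variable {V : Type*} [Fintype V] {G : SimpleGraph V}

theorem adjMatrix_mulVec_eq_nbrSum (y : V → ℝ) :
    (G.adjMatrix ℝ).mulVec y = nbrSum G y univ := by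
  ext v
  rw [SimpleGraph.adjMatrix_mulVec_apply, SimpleGraph.neighborFinset_eq_filter, nbrSum]

omit [Fintype V] in
theorem isHermitian_adjMatrix : (G.adjMatrix ℝ).IsHermitian := by
  rw [Matrix.IsHermitian, Matrix.conjTranspose_eq_transpose_of_trivial]
  exact G.isSymm_adjMatrix

theorem finite_spectrum_adjMatrix : (spectrum ℝ (G.adjMatrix ℝ)).Finite := by
  rw [isHermitian_adjMatrix.spectrum_real_eq_range_eigenvalues]
  exact Set.finite_range _

theorem posSemidef_graphRho_smul_one_sub_adjMatrix :
    (graphRho G • (1 : Matrix V V ℝ) - G.adjMatrix ℝ).PosSemidef := by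
  rw [Matrix.posSemidef_iff_isHermitian_and_spectrum_nonneg]
  constructor
  · exact (Matrix.isHermitian_one.smul (IsSelfAdjoint.all _)).sub isHermitian_adjMatrix
  · rw [← Algebra.algebraMap_eq_smul_one, ← spectrum.singleton_sub_eq]
    rintro _ ⟨r, rfl, s, hs, rfl⟩
    exact sub_nonneg.2 (le_csSup finite_spectrum_adjMatrix.bddAbove hs)

theorem graphRho_smul_one_sub_adjMatrix_mulVec (y : V → ℝ) :
    (graphRho G • (1 : Matrix V V ℝ) - G.adjMatrix ℝ).mulVec y =
      graphRho G • y - nbrSum G y univ := by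
  rw [Matrix.sub_mulVec, Matrix.smul_mulVec, Matrix.one_mulVec, adjMatrix_mulVec_eq_nbrSum]

theorem star_dotProduct_graphRho_smul_sub_nbrSum (y : V → ℝ) :
    star y ⬝ᵥ (graphRho G • y - nbrSum G y univ) =
      graphRho G * ∑ u, y u ^ 2 - ∑ u, y u * nbrSum G y univ u := by
  simp only [dotProduct, star_trivial, Pi.sub_apply, Pi.smul_apply, smul_eq_mul, mul_sub,
    sum_sub_distrib, mul_sum]
  congr! 2
  ring

theorem sum_mul_nbrSum_le_graphRho_mul (y : V → ℝ) :
    ∑ u, y u * nbrSum G y univ u ≤ graphRho G * ∑ u, y u ^ 2 := by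
  have := (posSemidef_graphRho_smul_one_sub_adjMatrix (G := G)).dotProduct_mulVec_nonneg y
  rw [graphRho_smul_one_sub_adjMatrix_mulVec, star_dotProduct_graphRho_smul_sub_nbrSum] at this
  linarith

theorem graphRho_mul_eq_nbrSum_of_le {y : V → ℝ}
    (hy : graphRho G * ∑ u, y u ^ 2 ≤ ∑ u, y u * nbrSum G y univ u) (v : V) :
    graphRho G * y v = nbrSum G y univ v := by
  have hzero : star y ⬝ᵥ (graphRho G • y - nbrSum G y univ) = 0 := by
    rw [star_dotProduct_graphRho_smul_sub_nbrSum]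
    linarith [sum_mul_nbrSum_le_graphRho_mul (G := G) y]
  rw [← graphRho_smul_one_sub_adjMatrix_mulVec,
    posSemidef_graphRho_smul_one_sub_adjMatrix.dotProduct_mulVec_zero_iff,
    graphRho_smul_one_sub_adjMatrix_mulVec, sub_eq_zero] at hzero
  exact congrFun hzero v

theorem exists_ne_zero_graphRho_mul_eq_nbrSum [Nonempty V] (G : SimpleGraph V) :
    ∃ b : V → ℝ, b ≠ 0 ∧ ∀ v, graphRho G * b v = nbrSum G b univ v := by
  have hA := isHermitian_adjMatrix (G := G)
  have hmem : graphRho G ∈ spectrum ℝ (G.adjMatrix ℝ) := by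
    refine Set.Nonempty.csSup_mem ?_ finite_spectrum_adjMatrix
    rw [hA.spectrum_real_eq_range_eigenvalues]
    exact Set.range_nonempty _
  obtain ⟨i, hi⟩ := hA.spectrum_real_eq_range_eigenvalues ▸ hmem
  refine ⟨⇑(hA.eigenvectorBasis i), fun h => ?_, fun v => ?_⟩
  · exact hA.eigenvectorBasis.orthonormal.ne_zero i (WithLp.ofLp_injective 2 h)
  · rw [← adjMatrix_mulVec_eq_nbrSum, hA.mulVec_eigenvectorBasis i, hi, Pi.smul_apply, smul_eq_mul]

variable (G) in
/-- A Perron vector of `G`: a nonnegative eigenvector of the adjacency matrix for the spectral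
radius, scaled so that its largest entry is `1`. -/
structure IsPerronVector (x : V → ℝ) : Prop where
  nonneg : ∀ v, 0 ≤ x v
  le_one : ∀ v, x v ≤ 1
  exists_eq_one : ∃ z, x z = 1
  graphRho_mul : ∀ v, graphRho G * x v = nbrSum G x univ v

theorem exists_isPerronVector [Nonempty V] (G : SimpleGraph V) : ∃ x, IsPerronVector G x := by
  obtain ⟨b, hb, hbρ⟩ := exists_ne_zero_graphRho_mul_eq_nbrSum G
  have hform : graphRho G * ∑ u, |b| u ^ 2 ≤ ∑ u, |b| u * nbrSum G |b| univ u := by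
    rw [mul_sum]
    refine sum_le_sum fun u _ => ?_
    calc graphRho G * |b| u ^ 2 = b u * nbrSum G b univ u := by
          rw [Pi.abs_apply, sq_abs, ← hbρ u]; ring
      _ ≤ |b u * nbrSum G b univ u| := le_abs_self _
      _ ≤ |b| u * nbrSum G |b| univ u := by
          rw [abs_mul]
          exact mul_le_mul_of_nonneg_left (abs_sum_le_sum_abs _ _) (abs_nonneg _)
  have hρ := graphRho_mul_eq_nbrSum_of_le hform
  obtain ⟨z, -, hz⟩ := exists_max_image univ |b| univ_nonempty
  have hzpos : 0 < |b| z := by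
    obtain ⟨v, hv⟩ := Function.ne_iff.1 hb
    exact (abs_pos.2 hv).trans_le (hz v (mem_univ v))
  refine ⟨fun v => |b| v / |b| z, fun v => div_nonneg (abs_nonneg _) hzpos.le,
    fun v => (div_le_one hzpos).2 (hz v (mem_univ v)), ⟨z, div_self hzpos.ne'⟩, fun v => ?_⟩
  rw [← mul_div_assoc, hρ v, nbrSum, nbrSum, sum_div]

theorem IsPerronVector.sum_mul_nbrSum {x : V → ℝ} (hx : IsPerronVector G x) :
    ∑ u, x u * nbrSum G x univ u = graphRho G * ∑ u, x u ^ 2 := by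
  rw [mul_sum]
  exact sum_congr rfl fun u _ => by rw [← hx.graphRho_mul u]; ring

theorem IsPerronVector.pos {x : V → ℝ} (hx : IsPerronVector G x) (hG : G.Connected) (v : V) :
    0 < x v := by
  obtain ⟨z, hz⟩ := hx.exists_eq_one
  obtain ⟨p⟩ := hG.preconnected v z
  suffices x v ≠ 0 from (hx.nonneg v).lt_of_ne' this
  induction p with
  | nil => simp [hz]
  | @cons u w z huw _ ih =>
    intro hv
    have hzero := hx.graphRho_mul u
    rw [hv, mul_zero, eq_comm, nbrSum, sum_eq_zero_iff_of_nonneg fun u _ => hx.nonneg u] at hzero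
    exact ih hz (hzero w (by simpa using huw))

theorem graphRho_lt_graphRho {H : SimpleGraph V} (hG : G.Connected) (h : G < H) :
    graphRho G < graphRho H := by
  have := hG.nonempty
  obtain ⟨x, hx⟩ := exists_isPerronVector G
  obtain ⟨u, v, huv, huv'⟩ : ∃ u v, H.Adj u v ∧ ¬ G.Adj u v := by
    by_contra! hle
    exact h.not_ge hle
  have hsub : ∀ w, ({v | G.Adj w v} : Finset V) ⊆ ({v | H.Adj w v} : Finset V) := fun w =>
    monotone_filter_right _ fun _ _ hw => h.le hw
  have hle : ∀ w, nbrSum G x univ w ≤ nbrSum H x univ w := fun w =>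
    sum_le_sum_of_subset_of_nonneg (hsub w) fun i _ _ => hx.nonneg i
  have hlt : nbrSum G x univ u < nbrSum H x univ u :=
    sum_lt_sum_of_subset (hsub u) (by simpa using huv) (by simpa using huv') (hx.pos hG v)
      fun i _ _ => hx.nonneg i
  have hsq : 0 ≤ ∑ u, x u ^ 2 := sum_nonneg fun u _ => sq_nonneg (x u)
  refine lt_of_mul_lt_mul_right ?_ hsq
  calc graphRho G * ∑ u, x u ^ 2 = ∑ w, x w * nbrSum G x univ w := hx.sum_mul_nbrSum.symm
    _ < ∑ w, x w * nbrSum H x univ w :=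
        sum_lt_sum (fun w _ => mul_le_mul_of_nonneg_left (hle w) (hx.nonneg w))
          ⟨u, mem_univ u, mul_lt_mul_of_pos_left hlt (hx.pos hG u)⟩
    _ ≤ graphRho H * ∑ u, x u ^ 2 := sum_mul_nbrSum_le_graphRho_mul x

theorem graphRho_congr {V' : Type*} [Fintype V'] {H : SimpleGraph V'} (e : G ≃g H) :
    graphRho G = graphRho H := by
  unfold graphRho
  rw [← AlgEquiv.spectrum_eq (Matrix.reindexAlgEquiv ℝ ℝ e.toEquiv)]
  congr 2
  exact e.reindex_adjMatrix ℝ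

end Spectral

section Join

variable {V : Type*} {K : Finset V}

variable (K) in
/-- The join of the complete graph on `K` and the empty graph on the other vertices; this is
`S_{n,k}^0` with an arbitrary set `K` in place of the first `k` vertices. -/
def joinGraph : SimpleGraph V where
  Adj u v := u ≠ v ∧ (u ∈ K ∨ v ∈ K)
  symm := ⟨fun _ _ h => ⟨h.1.symm, h.2.symm⟩⟩
  loopless := ⟨fun _ h => h.1 rfl⟩

theorem joinGraph_connected (hK : K.Nonempty) : (joinGraph K).Connected := by
  obtain ⟨u, hu⟩ := hK
  refine (SimpleGraph.connected_iff_exists_forall_reachable _).2 ⟨u, fun v => ?_⟩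
  rcases eq_or_ne u v with rfl | huv
  · rfl
  · exact SimpleGraph.Adj.reachable ⟨huv, Or.inl hu⟩

variable [Fintype V]

theorem sum_mul_nbrSum_joinGraph (y : V → ℝ) :
    ∑ u, y u * nbrSum (joinGraph K) y univ u =
      (∑ u ∈ K, y u) ^ 2 - ∑ u ∈ K, y u ^ 2 + 2 * (∑ u ∈ K, y u) * ∑ u ∈ Kᶜ, y u := by
  have hin : ∀ u ∈ K, y u * nbrSum (joinGraph K) y univ u =
      y u * (∑ v ∈ K, y v + ∑ v ∈ Kᶜ, y v) - y u ^ 2 := by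
    intro u hu
    have hfilter : ({v | (joinGraph K).Adj u v} : Finset V) = univ.erase u := by
      ext v
      simp [joinGraph, hu, eq_comm]
    rw [nbrSum, hfilter, sum_erase_eq_sub (mem_univ u), sum_add_sum_compl]
    ring
  have hout : ∀ u ∈ Kᶜ, y u * nbrSum (joinGraph K) y univ u = y u * ∑ v ∈ K, y v := by
    intro u hu
    have hfilter : ({v | (joinGraph K).Adj u v} : Finset V) = K := by
      ext v
      have hu := mem_compl.1 hu
      simp only [joinGraph, mem_filter, mem_univ, true_and, hu, false_or, and_iff_right_iff_imp]
      exact (ne_of_mem_of_not_mem · hu |>.symm)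
    rw [nbrSum, hfilter]
  rw [← sum_add_sum_compl K, sum_congr rfl hin, sum_congr rfl hout, sum_sub_distrib, ← sum_mul,
    ← sum_mul]
  ring

theorem sqrt_card_mul_sub_le_graphRho_joinGraph (hK : 0 < #K) (hK' : #K < Fintype.card V) :
    √(#K * (Fintype.card V - #K)) ≤ graphRho (joinGraph K) := by
  rw [← Nat.cast_sub hK'.le, ← card_compl]
  set k : ℝ := (#K : ℝ)
  set m : ℝ := (#Kᶜ : ℝ)
  have hk : 1 ≤ k := Nat.one_le_cast.2 hK
  have hm : 0 < m := Nat.cast_pos.2 (card_compl K ▸ Nat.sub_pos_of_lt hK')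
  have hk0 : 0 < k := by linarith
  let y : V → ℝ := fun v => if v ∈ K then √m else √k
  have hyK : ∀ v ∈ K, y v = √m := fun v hv => if_pos hv
  have hyK' : ∀ v ∈ Kᶜ, y v = √k := fun v hv => if_neg (mem_compl.1 hv)
  have hsumK : ∑ v ∈ K, y v = k * √m := by simp [sum_congr rfl hyK, k]
  have hsumK' : ∑ v ∈ Kᶜ, y v = m * √k := by rw [sum_congr rfl hyK', sum_const, nsmul_eq_mul]
  have hsqK : ∑ v ∈ K, y v ^ 2 = k * m := by
    rw [sum_congr rfl fun v hv => by rw [hyK v hv, Real.sq_sqrt hm.le], sum_const, nsmul_eq_mul]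
  have hsqK' : ∑ v ∈ Kᶜ, y v ^ 2 = m * k := by
    rw [sum_congr rfl fun v hv => by rw [hyK' v hv, Real.sq_sqrt hk0.le], sum_const, nsmul_eq_mul]
  have hray := sum_mul_nbrSum_le_graphRho_mul (G := joinGraph K) y
  rw [sum_mul_nbrSum_joinGraph, ← sum_add_sum_compl K (fun v => y v ^ 2), hsumK, hsumK', hsqK,
    hsqK', mul_pow, Real.sq_sqrt hm.le] at hray
  rw [Real.sqrt_mul hk0.le]
  have hclique : 0 ≤ k ^ 2 * m - k * m := by nlinarith [mul_pos hk0 hm]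
  refine le_of_mul_le_mul_left ?_ (mul_pos two_pos (mul_pos hk0 hm))
  linarith

end Join

section HeavySet

variable {V W : Type*} [Fintype V] [Fintype W] {G : SimpleGraph V} {F : SimpleGraph W}
  {x : V → ℝ} {k : ℕ} {β σ τ : ℝ} {L : Finset V}

variable (x σ) in
/-- The set of vertices at which the vector `x` is at least `σ`. -/
noncomputable def largeEntries : Finset V := {v | σ ≤ x v}

theorem mem_largeEntries {v : V} : v ∈ largeEntries x σ ↔ σ ≤ x v := by
  simp [largeEntries]

theorem mul_graphRho_mul_card_largeEntries_le (hF : F.IsTree) (hG : F.Free G)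
    (hx : IsPerronVector G x) (hρ : 0 ≤ graphRho G) (σ : ℝ) :
    σ * graphRho G * #(largeEntries x σ) ≤ 2 * Fintype.card W * Fintype.card V := by
  calc σ * graphRho G * #(largeEntries x σ) = #(largeEntries x σ) • (graphRho G * σ) := by
        rw [nsmul_eq_mul]
        ring
    _ ≤ ∑ v ∈ largeEntries x σ, graphRho G * x v :=
        card_nsmul_le_sum _ _ _ fun v hv => mul_le_mul_of_nonneg_left (mem_largeEntries.1 hv) hρ
    _ ≤ ∑ v, graphRho G * x v :=
        sum_le_sum_of_subset_of_nonneg (subset_univ _) fun v _ _ => mul_nonneg hρ (hx.nonneg v)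
    _ = ∑ v, nbrSum G x univ v := sum_congr rfl fun v _ => hx.graphRho_mul v
    _ ≤ ∑ v, nbrSum G 1 univ v := sum_le_sum fun v _ => nbrSum_mono fun u _ => hx.le_one u
    _ ≤ 2 * Fintype.card W * Fintype.card V := sum_nbrSum_one_le hF hG univ

theorem card_largeEntries_le (hF : F.IsTree) (hG : F.Free G) (hx : IsPerronVector G x)
    (hσ : 0 < σ) (hρ : 2 * Fintype.card W ≤ σ ^ 2 * graphRho G) :
    #(largeEntries x σ) ≤ σ * Fintype.card V := by
  have := hF.connected.nonempty
  have hW : (0 : ℝ) < 2 * Fintype.card W := by positivity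
  have hρ0 : 0 < graphRho G := pos_of_mul_pos_right (hW.trans_le hρ) (by positivity)
  refine le_of_mul_le_mul_left ?_ (mul_pos hσ hρ0)
  calc σ * graphRho G * #(largeEntries x σ) ≤ 2 * Fintype.card W * Fintype.card V :=
        mul_graphRho_mul_card_largeEntries_le hF hG hx hρ0.le σ
    _ ≤ σ ^ 2 * graphRho G * Fintype.card V := by gcongr
    _ = σ * graphRho G * (σ * Fintype.card V) := by ring

theorem graphRho_sq_mul_le (hF : F.IsTree) (hG : F.Free G) (hx : IsPerronVector G x)
    (hσ : 0 ≤ σ) (hL : ∀ v ∉ L, x v ≤ σ) (u : V) :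
    graphRho G ^ 2 * x u ≤ nbrSum G (nbrSum G x L) Lᶜ u +
      2 * Fintype.card W * (#L + σ * Fintype.card V) := by
  have hrow : ∀ w, graphRho G * x w ≤ nbrSum G x L w + σ * nbrSum G 1 univ w := by
    intro w
    rw [hx.graphRho_mul w, ← nbrSum_add_nbrSum_compl (S := L)]
    refine add_le_add_right ((nbrSum_le_card_mul fun v hv => hL v (mem_compl.1 hv)).trans ?_) _
    rw [mul_comm, nbrSum_one]
    gcongr
    exact subset_univ _
  have hinside : nbrSum G (nbrSum G x L) L u ≤ 2 * Fintype.card W * #L :=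
    calc nbrSum G (nbrSum G x L) L u ≤ ∑ w ∈ L, nbrSum G x L w :=
          nbrSum_le_sum fun w _ => nbrSum_nonneg fun v _ => hx.nonneg v
      _ ≤ ∑ w ∈ L, nbrSum G 1 L w := sum_le_sum fun w _ => nbrSum_mono fun v _ => hx.le_one v
      _ ≤ 2 * Fintype.card W * #L := sum_nbrSum_one_le hF hG L
  have hsmall : nbrSum G (fun w => σ * nbrSum G 1 univ w) univ u ≤
      σ * (2 * Fintype.card W * Fintype.card V) :=
    calc nbrSum G (fun w => σ * nbrSum G 1 univ w) univ u ≤ ∑ w, σ * nbrSum G 1 univ w :=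
          nbrSum_le_sum fun w _ => mul_nonneg hσ (nbrSum_nonneg fun v _ => zero_le_one)
      _ ≤ σ * (2 * Fintype.card W * Fintype.card V) := by
          rw [← mul_sum]
          exact mul_le_mul_of_nonneg_left (sum_nbrSum_one_le hF hG univ) hσ
  calc graphRho G ^ 2 * x u = nbrSum G (fun w => graphRho G * x w) univ u := by
        rw [pow_two, mul_assoc, hx.graphRho_mul u, nbrSum, nbrSum, mul_sum]
    _ ≤ nbrSum G (fun w => nbrSum G x L w + σ * nbrSum G 1 univ w) univ u :=
        nbrSum_mono fun w _ => hrow w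
    _ = nbrSum G (nbrSum G x L) L u + nbrSum G (nbrSum G x L) Lᶜ u +
        nbrSum G (fun w => σ * nbrSum G 1 univ w) univ u := by
        rw [nbrSum_add_nbrSum_compl, nbrSum, sum_add_distrib, nbrSum, nbrSum]
    _ ≤ _ := by linarith

variable (G x k τ) in
/-- `L` carries the walks of length two counted by `x`, up to errors of relative size `τ`: the
entries of `x` off `L` are at most `τ`, every vertex `u` starts about `k n x u` weighted walks
`u, w, v` with `w ∉ L` and `v ∈ L`, and vertices off `L` have at most `k` neighbours in `L` on
average. -/
structure IsHeavySet (L : Finset V) : Prop where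
  le_of_notMem : ∀ v ∉ L, x v ≤ τ
  sum_nbrSum_one_le : ∀ Q ⊆ Lᶜ, ∑ q ∈ Q, nbrSum G 1 L q ≤ k * #Q + τ * Fintype.card V
  mul_le_nbrSum : ∀ u, k * Fintype.card V * x u ≤
    nbrSum G (nbrSum G x L) Lᶜ u + 5 * τ * Fintype.card V

theorem isHeavySet_largeEntries (hF : F.IsTree) (hG : F.Free G) (hx : IsPerronVector G x)
    (hW : Fintype.card W ≤ 2 * k + 3) (hσ : 0 < σ) (hτ : Fintype.card W * σ ≤ τ)
    (hρ : 2 * Fintype.card W ≤ σ ^ 2 * graphRho G)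
    (hρk : k * (Fintype.card V - k) ≤ graphRho G ^ 2) (hk : k ^ 2 ≤ τ * Fintype.card V) :
    IsHeavySet G x k τ (largeEntries x σ) := by
  have := hF.connected.nonempty
  have hsmall : ∀ v ∉ largeEntries x σ, x v ≤ σ := fun v hv =>
    (not_le.1 (mt mem_largeEntries.2 hv)).le
  have hcard : Fintype.card W * (#(largeEntries x σ) : ℝ) ≤ τ * Fintype.card V :=
    calc Fintype.card W * (#(largeEntries x σ) : ℝ)
        ≤ Fintype.card W * (σ * Fintype.card V) := by
          gcongr
          exact card_largeEntries_le hF hG hx hσ hρ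
      _ = Fintype.card W * σ * Fintype.card V := by ring
      _ ≤ τ * Fintype.card V := by gcongr
  have hστ : σ ≤ τ :=
    (le_mul_of_one_le_left hσ.le (mod_cast Fintype.card_pos)).trans hτ
  refine ⟨fun v hv => (hsmall v hv).trans hστ, fun Q hQ => ?_, fun u => ?_⟩
  · obtain ⟨A, hA, hAcard⟩ := exists_isColorClass hF ∅
    rw [sdiff_empty, card_empty] at hAcard
    have hcount : ∑ q ∈ Q, (#{p ∈ largeEntries x σ | G.Adj q p} : ℝ) ≤
        k * #Q + Fintype.card W * #(largeEntries x σ) :=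
      mod_cast sum_card_adj_between_le hF hG hA (by omega) (largeEntries x σ) Q
        (subset_compl_iff_disjoint_left.1 hQ)
    simp only [nbrSum_one]
    linarith
  · have hwalk := graphRho_sq_mul_le hF hG hx hσ.le hsmall u
    have hmain : k * (Fintype.card V - k) * x u ≤ graphRho G ^ 2 * x u :=
      mul_le_mul_of_nonneg_right hρk (hx.nonneg u)
    have hksq : (k : ℝ) ^ 2 * x u ≤ k ^ 2 :=
      mul_le_of_le_one_right (by positivity) (hx.le_one u)
    have hσn : Fintype.card W * σ * Fintype.card V ≤ τ * Fintype.card V := by gcongr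
    linarith

namespace IsHeavySet

theorem sub_mul_le_nbrSum (hL : IsHeavySet G x k τ L) (hx : ∀ v, x v ≤ 1) (hk : 1 ≤ k)
    (hτ : 0 ≤ τ) (u : V) : (x u - 6 * τ) * Fintype.card V ≤ nbrSum G 1 Lᶜ u := by
  have hwalk : nbrSum G (nbrSum G x L) Lᶜ u ≤ k * nbrSum G 1 Lᶜ u + τ * Fintype.card V := by
    rw [nbrSum_one]
    exact (nbrSum_mono fun w _ => nbrSum_mono fun v _ => hx v).trans
      (hL.sum_nbrSum_one_le _ (filter_subset _ _))
  have hku := hL.mul_le_nbrSum u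
  have hk : (1 : ℝ) ≤ k := mod_cast hk
  have herr : 0 ≤ τ * Fintype.card V := by positivity
  by_contra! hlt
  have := mul_le_mul_of_nonneg_right hk
    (show 0 ≤ x u * Fintype.card V - nbrSum G 1 Lᶜ u by linarith)
  linarith

theorem sum_nbrSum_one_compl_le (hL : IsHeavySet G x k τ L) :
    ∑ v ∈ L, nbrSum G 1 Lᶜ v ≤ (k + τ) * Fintype.card V := by
  have hswap := sum_mul_nbrSum_comm (G := G) (x := 1) (y := 1) L Lᶜ
  simp only [Pi.one_apply, one_mul] at hswap
  have hcard : (k : ℝ) * #Lᶜ ≤ k * Fintype.card V := by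
    gcongr
    exact card_le_univ _
  linarith [hL.sum_nbrSum_one_le Lᶜ subset_rfl]

theorem sub_mul_le_sum_mul_nbrSum (hL : IsHeavySet G x k τ L) (hx : ∀ v, 0 ≤ x v)
    (hz : ∃ z, x z = 1) : (k - 5 * τ) * Fintype.card V ≤ ∑ v ∈ L, x v * nbrSum G 1 Lᶜ v := by
  obtain ⟨z, hz⟩ := hz
  have hwalk := hL.mul_le_nbrSum z
  have hswap := sum_mul_nbrSum_comm (G := G) (x := 1) (y := x) L Lᶜ
  simp only [Pi.one_apply, one_mul] at hswap
  have hle : nbrSum G (nbrSum G x L) Lᶜ z ≤ ∑ w ∈ Lᶜ, nbrSum G x L w :=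
    nbrSum_le_sum fun w _ => nbrSum_nonneg fun v _ => hx v
  rw [hz] at hwalk
  linarith

theorem one_sub_mul_nbrSum_le (hL : IsHeavySet G x k τ L) (hx : IsPerronVector G x) {v : V}
    (hv : v ∈ L) : (1 - x v) * nbrSum G 1 Lᶜ v ≤ 6 * τ * Fintype.card V := by
  calc (1 - x v) * nbrSum G 1 Lᶜ v ≤ ∑ v ∈ L, (1 - x v) * nbrSum G 1 Lᶜ v :=
        single_le_sum (f := fun v => (1 - x v) * nbrSum G 1 Lᶜ v) (fun v _ =>
          mul_nonneg (sub_nonneg.2 (hx.le_one v)) (nbrSum_nonneg fun _ _ => zero_le_one)) hv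
    _ = ∑ v ∈ L, nbrSum G 1 Lᶜ v - ∑ v ∈ L, x v * nbrSum G 1 Lᶜ v := by
        simp only [sub_mul, one_mul, sum_sub_distrib]
    _ ≤ 6 * τ * Fintype.card V := by
        linarith [hL.sum_nbrSum_one_compl_le, hL.sub_mul_le_sum_mul_nbrSum hx.nonneg
          hx.exists_eq_one]

theorem one_sub_le_of_le (hL : IsHeavySet G x k (β ^ 2 / 18) L) (hx : IsPerronVector G x)
    (hk : 1 ≤ k) (hβ0 : 0 < β) (hβ : β ≤ 1 / 40) {v : V} (hv : β ≤ x v) :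
    1 - 2 / 3 * β ≤ x v := by
  have : Nonempty V := ⟨v⟩
  have hτ : β ^ 2 / 18 ≤ β / 720 := by nlinarith
  have hvL : v ∈ L := by
    by_contra hvL
    linarith [hL.le_of_notMem v hvL]
  have hdeg := hL.sub_mul_le_nbrSum hx.le_one hk (by positivity) v
  have hn : (0 : ℝ) < Fintype.card V := by positivity
  have hhalf : β / 2 * Fintype.card V ≤ nbrSum G 1 Lᶜ v :=
    (mul_le_mul_of_nonneg_right (by linarith) hn.le).trans hdeg
  have hdef : (1 - x v) * (β / 2 * Fintype.card V) ≤ 6 * (β ^ 2 / 18) * Fintype.card V :=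
    (mul_le_mul_of_nonneg_left hhalf (sub_nonneg.2 (hx.le_one v))).trans
      (hL.one_sub_mul_nbrSum_le hx hvL)
  have hscaled : β * Fintype.card V * (1 - x v) ≤ β * Fintype.card V * (2 / 3 * β) := by linarith
  linarith [le_of_mul_le_mul_left hscaled (mul_pos hβ0 hn)]

theorem le_card_largeEntries (hL : IsHeavySet G x k (β ^ 2 / 18) L) (hx : IsPerronVector G x)
    (hβ0 : 0 < β) (hβ : β ≤ 1 / 40) (hβk : β * k ≤ 1 / 16) : k ≤ #(largeEntries x β) := by
  obtain ⟨z, -⟩ := hx.exists_eq_one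
  have : Nonempty V := ⟨z⟩
  have hn : (0 : ℝ) < Fintype.card V := by positivity
  have hτ : β ^ 2 / 18 ≤ β / 720 := by nlinarith
  have hKL : largeEntries x β ⊆ L := by
    intro v hv
    by_contra hvL
    linarith [hL.le_of_notMem v hvL, mem_largeEntries.1 hv]
  have hK : ∑ v ∈ largeEntries x β, x v * nbrSum G 1 Lᶜ v ≤
      #(largeEntries x β) * Fintype.card V := by
    rw [← nsmul_eq_mul]
    refine sum_le_card_nsmul _ _ _ fun v _ => ?_
    have hcard : nbrSum G 1 Lᶜ v ≤ Fintype.card V := by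
      rw [nbrSum_one]
      exact mod_cast card_le_univ _
    exact (mul_le_of_le_one_left (nbrSum_nonneg fun _ _ => zero_le_one) (hx.le_one v)).trans hcard
  have hrest : ∑ v ∈ L \ largeEntries x β, x v * nbrSum G 1 Lᶜ v ≤
      β * ((k + β ^ 2 / 18) * Fintype.card V) :=
    calc ∑ v ∈ L \ largeEntries x β, x v * nbrSum G 1 Lᶜ v
        ≤ ∑ v ∈ L \ largeEntries x β, β * nbrSum G 1 Lᶜ v :=
          sum_le_sum fun v hv => mul_le_mul_of_nonneg_right
            (not_le.1 (mt mem_largeEntries.2 (mem_sdiff.1 hv).2)).le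
            (nbrSum_nonneg fun _ _ => zero_le_one)
      _ ≤ ∑ v ∈ L, β * nbrSum G 1 Lᶜ v :=
          sum_le_sum_of_subset_of_nonneg sdiff_subset fun v _ _ =>
            mul_nonneg hβ0.le (nbrSum_nonneg fun _ _ => zero_le_one)
      _ ≤ β * ((k + β ^ 2 / 18) * Fintype.card V) := by
          rw [← mul_sum]
          exact mul_le_mul_of_nonneg_left hL.sum_nbrSum_one_compl_le hβ0.le
  have hsum := hL.sub_mul_le_sum_mul_nbrSum hx.nonneg hx.exists_eq_one
  rw [← sum_sdiff hKL] at hsum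
  have hlt : (k - 1 : ℝ) * Fintype.card V < #(largeEntries x β) * Fintype.card V := by
    have hcoeff : β * (k + β ^ 2 / 18) + 5 * (β ^ 2 / 18) < 1 := by nlinarith
    linarith [mul_lt_mul_of_pos_right hcoeff hn]
  have : (k : ℝ) < (#(largeEntries x β) + 1 : ℕ) := by
    push_cast
    linarith [lt_of_mul_lt_mul_right hlt hn.le]
  exact Nat.lt_succ_iff.1 (mod_cast this)

end IsHeavySet

variable (G) in
/-- The set of common neighbours of the vertices in `K`. -/
noncomputable def commonNbrs (K : Finset V) : Finset V := {v | ∀ u ∈ K, G.Adj u v}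

theorem mem_commonNbrs {K : Finset V} {v : V} : v ∈ commonNbrs G K ↔ ∀ u ∈ K, G.Adj u v := by
  simp [commonNbrs]

theorem isCompleteBetween_commonNbrs (K : Finset V) :
    G.IsCompleteBetween K (commonNbrs G K) :=
  fun u hu _ hv => mem_commonNbrs.1 hv u hu

theorem le_card_commonNbrs (K : Finset V)
    (hK : ∀ u ∈ K, (1 - β) * Fintype.card V ≤ #{v | G.Adj u v}) :
    (1 - #K * β) * Fintype.card V ≤ #(commonNbrs G K) := by
  have hcompl : ∀ S : Finset V, (#Sᶜ : ℝ) = Fintype.card V - #S := fun S => by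
    rw [card_compl, Nat.cast_sub (card_le_univ S)]
  have hunion : (commonNbrs G K)ᶜ ⊆
      K.biUnion fun u => ({v | G.Adj u v} : Finset V)ᶜ := fun v hv => by
    simpa [mem_commonNbrs] using hv
  have hle : (#(commonNbrs G K)ᶜ : ℝ) ≤ #K * (β * Fintype.card V) :=
    calc (#(commonNbrs G K)ᶜ : ℝ)
        ≤ ∑ u ∈ K, (#({v | G.Adj u v} : Finset V)ᶜ : ℝ) :=
          mod_cast (card_le_card hunion).trans card_biUnion_le
      _ ≤ #K • (β * Fintype.card V) :=
          sum_le_card_nsmul _ _ _ fun u hu => by linarith [hcompl {v | G.Adj u v}, hK u hu]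
      _ = #K * (β * Fintype.card V) := nsmul_eq_mul _ _
  linarith [hcompl (commonNbrs G K)]

variable (G x β) in
/-- The vertices of `K` have entries of `x` close to `1` and are adjacent to almost all vertices,
while the entries of `x` off `K` are small. -/
structure IsCore (K : Finset V) : Prop where
  one_sub_le : ∀ v ∈ K, 1 - β ≤ x v
  le_of_notMem : ∀ v ∉ K, x v ≤ β
  le_card_adj : ∀ v ∈ K, (1 - β) * Fintype.card V ≤ #{u | G.Adj v u}

theorem card_le_of_free (hF : F.IsTree) (hG : F.Free G) (hW : Fintype.card W ≤ 2 * k + 3)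
    (hβ : (k + 1) * β ≤ 1 / 2) (hn : 2 * Fintype.card W ≤ Fintype.card V) {K : Finset V}
    (hK : ∀ v ∈ K, (1 - β) * Fintype.card V ≤ #{u | G.Adj v u}) : #K ≤ k := by
  by_contra! hcon
  obtain ⟨A, hA, hAcard⟩ := exists_isColorClass hF ∅
  rw [sdiff_empty, card_empty] at hAcard
  obtain ⟨K', hK'K, hK'card⟩ := exists_subset_card_eq (s := K) (n := k + 1) hcon
  have hcommon := le_card_commonNbrs (G := G) K' fun u hu => hK u (hK'K hu)
  rw [hK'card, Nat.cast_add, Nat.cast_one] at hcommon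
  have hR : (Fintype.card W : ℝ) ≤ #(commonNbrs G K') := by
    have hn : 2 * (Fintype.card W : ℝ) ≤ Fintype.card V := mod_cast hn
    nlinarith
  exact hG (isContained_of_complete_bipartite (isCompleteBetween_commonNbrs K') (mod_cast hR) hA
    (by omega))

theorem exists_isCore (hF : F.IsTree) (hG : F.Free G) (hx : IsPerronVector G x) (hk : 1 ≤ k)
    (hW : Fintype.card W ≤ 2 * k + 3) (hβ0 : 0 < β) (hβ : 8 * (2 * k + 3) * β ≤ 1) (hσ : 0 < σ)
    (hσβ : Fintype.card W * σ ≤ β ^ 2 / 18) (hρ : 2 * Fintype.card W ≤ σ ^ 2 * graphRho G)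
    (hρk : k * (Fintype.card V - k) ≤ graphRho G ^ 2)
    (hkn : k ^ 2 ≤ β ^ 2 / 18 * Fintype.card V)
    (hn : 2 * Fintype.card W ≤ Fintype.card V) : ∃ K, #K = k ∧ IsCore G x β K := by
  have hL := isHeavySet_largeEntries hF hG hx hW hσ hσβ hρ hρk hkn
  have hk1 : (1 : ℝ) ≤ k := mod_cast hk
  have hβ40 : β ≤ 1 / 40 := by nlinarith
  have hlarge : ∀ v ∈ largeEntries x β, 1 - 2 / 3 * β ≤ x v := fun v hv =>
    hL.one_sub_le_of_le hx hk hβ0 hβ40 (mem_largeEntries.1 hv)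
  have hcore : IsCore G x β (largeEntries x β) := by
    refine ⟨fun v hv => by linarith [hlarge v hv],
      fun v hv => (not_le.1 (mt mem_largeEntries.2 hv)).le, fun v hv => ?_⟩
    have hdeg : nbrSum G 1 (largeEntries x σ)ᶜ v ≤ #{u | G.Adj v u} := by
      rw [nbrSum_one]
      gcongr
      exact subset_univ _
    refine (mul_le_mul_of_nonneg_right ?_ (Nat.cast_nonneg _)).trans
      ((hL.sub_mul_le_nbrSum hx.le_one hk (by positivity) v).trans hdeg)
    nlinarith [hlarge v hv]
  exact ⟨_, le_antisymm (card_le_of_free hF hG hW (by nlinarith) hn hcore.le_card_adj)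
    (hL.le_card_largeEntries hx hβ0 hβ40 (by nlinarith)), hcore⟩

end HeavySet

section Comparison

variable {V : Type*} [Fintype V] {G : SimpleGraph V} {x : V → ℝ} {ρ : ℝ} {K : Finset V}

theorem sq_sum_sub_sum_sq_add_le (hρ0 : 0 < ρ) (hρ : graphRho (joinGraph K) ≤ ρ) (x : V → ℝ) :
    (∑ u ∈ K, x u) ^ 2 - ∑ u ∈ K, x u ^ 2 + #Kᶜ * ((∑ u ∈ K, x u) ^ 2 / ρ) ≤
      ρ * ∑ u ∈ K, x u ^ 2 := by
  set s := ∑ u ∈ K, x u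
  set q := ∑ u ∈ K, x u ^ 2
  -- `s / ρ` is the entry off `K` of an eigenvector of the join with eigenvalue `ρ` and sum `s`
  -- on `K`
  let y : V → ℝ := fun v => if v ∈ K then x v else s / ρ
  have hyK : ∀ v ∈ K, y v = x v := fun v hv => if_pos hv
  have hyK' : ∀ v ∈ Kᶜ, y v = s / ρ := fun v hv => if_neg (mem_compl.1 hv)
  have hsumK : ∑ v ∈ K, y v = s := sum_congr rfl hyK
  have hsqK : ∑ v ∈ K, y v ^ 2 = q := sum_congr rfl fun v hv => by rw [hyK v hv]
  have hsumK' : ∑ v ∈ Kᶜ, y v = #Kᶜ * (s / ρ) := by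
    rw [sum_congr rfl hyK', sum_const, nsmul_eq_mul]
  have hsqK' : ∑ v ∈ Kᶜ, y v ^ 2 = #Kᶜ * (s / ρ) ^ 2 := by
    rw [sum_congr rfl fun v hv => by rw [hyK' v hv], sum_const, nsmul_eq_mul]
  have hray : s ^ 2 - q + 2 * s * (#Kᶜ * (s / ρ)) ≤ ρ * (q + #Kᶜ * (s / ρ) ^ 2) := by
    have hray := sum_mul_nbrSum_le_graphRho_mul (G := joinGraph K) y
    rw [sum_mul_nbrSum_joinGraph, ← sum_add_sum_compl K (fun v => y v ^ 2), hsumK, hsumK', hsqK,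
      hsqK'] at hray
    have hq : 0 ≤ q := sum_nonneg fun u _ => sq_nonneg (x u)
    exact hray.trans (mul_le_mul_of_nonneg_right hρ (by positivity))
  have hout : 2 * s * (#Kᶜ * (s / ρ)) - ρ * (#Kᶜ * (s / ρ) ^ 2) = #Kᶜ * (s ^ 2 / ρ) := by
    field_simp
    ring
  linarith

theorem sum_deviation_le (hx : IsPerronVector G x) (hρ0 : 0 < graphRho G)
    (hρ : graphRho (joinGraph K) ≤ graphRho G) :
    ∑ u ∈ K, x u * (∑ v ∈ K, x v - x u - nbrSum G x K u) +
      ∑ w ∈ Kᶜ, ((∑ v ∈ K, x v - graphRho G * x w) ^ 2 / graphRho G +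
        2 * (x w * (∑ v ∈ K, x v - nbrSum G x K w))) ≤
    ∑ w ∈ Kᶜ, x w * nbrSum G x Kᶜ w := by
  have hray := sq_sum_sub_sum_sq_add_le hρ0 hρ x
  set s := ∑ u ∈ K, x u with hs
  have hK : ∑ u ∈ K, x u * (s - x u - nbrSum G x K u) =
      s ^ 2 - ∑ u ∈ K, x u ^ 2 - ∑ u ∈ K, x u * nbrSum G x K u := by
    simp only [mul_sub, sum_sub_distrib, ← sum_mul, ← hs, ← pow_two]
  have hK' : ∑ w ∈ Kᶜ, ((s - graphRho G * x w) ^ 2 / graphRho G +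
      2 * (x w * (s - nbrSum G x K w))) = #Kᶜ * (s ^ 2 / graphRho G) -
        ∑ w ∈ Kᶜ, x w * nbrSum G x K w + ∑ w ∈ Kᶜ, x w * nbrSum G x Kᶜ w := by
    rw [← nsmul_eq_mul, ← sum_const, ← sum_sub_distrib, ← sum_add_distrib]
    refine sum_congr rfl fun w _ => ?_
    have hsq : (s - graphRho G * x w) ^ 2 / graphRho G =
        s ^ 2 / graphRho G - 2 * (x w * s) + x w * (graphRho G * x w) := by
      field_simp
      ring
    rw [hsq, hx.graphRho_mul w, ← nbrSum_add_nbrSum_compl (S := K)]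
    ring
  have hsq : graphRho G * ∑ u ∈ K, x u ^ 2 =
      ∑ u ∈ K, x u * nbrSum G x K u + ∑ w ∈ Kᶜ, x w * nbrSum G x K w := by
    rw [← sum_mul_nbrSum_comm K Kᶜ, ← sum_add_distrib, mul_sum]
    refine sum_congr rfl fun u _ => ?_
    rw [← mul_add, nbrSum_add_nbrSum_compl, ← hx.graphRho_mul u]
    ring
  linarith

end Comparison

section Completion

variable {V W : Type*} [Fintype W] {G : SimpleGraph V} {F : SimpleGraph W} {x : V → ℝ}
  {β ρ s : ℝ} {K R : Finset V}

theorem sq_sub_le_deviation {k : ℝ} (hs0 : 0 ≤ s) (hs : s ≤ k) (hρ : 8 * k ^ 2 + 1 < ρ) (t : ℝ) :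
    t ^ 2 - 1 / (8 * ρ) ≤ (s - ρ * t) ^ 2 / ρ := by
  have hρ1 : 0 < ρ - 1 := by nlinarith
  have hρ0 : 0 < ρ := by linarith
  have hs2 : 0 ≤ ρ * ((ρ - 1) / 8 - s ^ 2) := mul_nonneg hρ0.le (by nlinarith)
  have hsq : 0 ≤ ρ * (ρ - 1) * ((s - ρ * t) ^ 2 - t ^ 2 * ρ + 1 / 8) := by
    linear_combination sq_nonneg ((ρ - 1) * ρ * t - ρ * s) + hs2
  have hpos := nonneg_of_mul_nonneg_right hsq (mul_pos hρ0 hρ1)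
  rw [le_div_iff₀ hρ0, sub_mul]
  field_simp
  linarith

theorem sum_mul_nbrSum_le_of_edge_unique
    (hR : ∀ ⦃a b a' b'⦄, G.Adj a b → G.Adj a' b' → a ∈ R → b ∈ R → a' ∈ R → b' ∈ R →
      a' = a ∧ b' = b ∨ a' = b ∧ b' = a)
    {k : ℝ} (hs0 : 0 ≤ s) (hs : s ≤ k) (hρ : 8 * k ^ 2 + 1 < ρ) :
    ∑ u ∈ R, x u * nbrSum G x R u ≤ ∑ u ∈ R, (s - ρ * x u) ^ 2 / ρ + 1 / (4 * ρ) := by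
  have hρ0 : 0 < ρ := by nlinarith
  by_cases! hedge : ∃ a ∈ R, ∃ b ∈ R, G.Adj a b
  · obtain ⟨a, ha, b, hb, hab⟩ := hedge
    have hab' : {a, b} ⊆ R := insert_subset ha (singleton_subset_iff.2 hb)
    have hsum : ∑ u ∈ R, x u * nbrSum G x R u = 2 * (x a * x b) := by
      have hfilter : {p ∈ R ×ˢ R | G.Adj p.1 p.2} = {(a, b), (b, a)} := by
        ext ⟨u, v⟩
        simp only [mem_filter, mem_product, mem_insert, mem_singleton, Prod.mk.injEq]
        refine ⟨fun h => hR hab h.2 ha hb h.1.1 h.1.2, ?_⟩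
        rintro (⟨rfl, rfl⟩ | ⟨rfl, rfl⟩)
        exacts [⟨⟨ha, hb⟩, hab⟩, ⟨⟨hb, ha⟩, hab.symm⟩]
      simp only [nbrSum_eq_sum_ite, mul_sum, mul_ite, mul_zero]
      rw [← sum_product', ← sum_filter, hfilter, sum_pair (by simp [hab.ne])]
      ring
    have hdev : ∑ u ∈ {a, b}, (s - ρ * x u) ^ 2 / ρ ≤ ∑ u ∈ R, (s - ρ * x u) ^ 2 / ρ :=
      sum_le_sum_of_subset_of_nonneg hab' fun u _ _ => by positivity
    rw [sum_pair hab.ne] at hdev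
    have hquarter : 1 / (4 * ρ) = 1 / (8 * ρ) + 1 / (8 * ρ) := by
      field_simp
      norm_num
    linarith [two_mul_le_add_sq (x a) (x b), sq_sub_le_deviation hs0 hs hρ (x a),
      sq_sub_le_deviation hs0 hs hρ (x b)]
  · have hzero : ∀ u ∈ R, x u * nbrSum G x R u = 0 := fun u hu => by
      rw [nbrSum, filter_false_of_mem (hedge u hu), sum_empty, mul_zero]
    rw [sum_eq_zero hzero]
    positivity

variable [Fintype V]

theorem sum_mul_nbrSum_compl_le (hF : F.IsTree) (hd : 3 ≤ F.diam) (hG : F.Free G)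
    (hW : Fintype.card W ≤ 2 * #K + 3) (hKR : G.IsCompleteBetween K R)
    (hR : 2 * Fintype.card W ≤ #R) (hx0 : ∀ v, 0 ≤ x v) (hxβ : ∀ v ∉ K, x v ≤ β)
    (hβ0 : 0 ≤ β) (hβ : 8 * (2 * #K + 3) * β ≤ 1) (hs0 : 0 ≤ s) (hs : s ≤ #K)
    (hρ : 8 * (#K : ℝ) ^ 2 + 1 < ρ) :
    ∑ w ∈ Kᶜ, x w * nbrSum G x Kᶜ w ≤
      1 / 2 * ∑ w ∈ Kᶜ \ R, x w + (∑ u ∈ R, (s - ρ * x u) ^ 2 / ρ + 1 / (4 * ρ)) := by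
  have hRK : R ⊆ Kᶜ := fun v hv => mem_compl.2 (Set.disjoint_right.1 hKR.disjoint hv)
  have hEK : ∀ v ∈ Kᶜ \ R, v ∉ K := fun v hv => mem_compl.1 (mem_sdiff.1 hv).1
  have hEE := sum_mul_nbrSum_le hF hG (Kᶜ \ R) (fun v _ => hx0 v) fun v hv => hxβ v (hEK v hv)
  have hRR := sum_mul_nbrSum_le_of_edge_unique (x := x)
    (fun _ _ _ _ => edge_unique_of_free hF hd hG hW hKR hR) hs0 hs hρ
  have hER : ∑ w ∈ Kᶜ \ R, x w * nbrSum G x R w ≤ β * ∑ w ∈ Kᶜ \ R, x w := by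
    rw [mul_sum]
    refine sum_le_sum fun w hw => ?_
    rw [mul_comm]
    refine mul_le_mul_of_nonneg_right ?_ (hx0 w)
    have hone : (#{v ∈ R | G.Adj w v} : ℝ) ≤ 1 :=
      mod_cast card_adj_le_one_of_free hF hG hW hKR hR (hEK w hw)
    exact (nbrSum_le_card_mul fun v hv => hxβ v (mem_compl.1 (hRK hv))).trans
      (mul_le_of_le_one_left hβ0 hone)
  have hcoeff : 2 * Fintype.card W * β + 2 * β ≤ 1 / 2 := by
    have hWβ : Fintype.card W * β ≤ (2 * #K + 3) * β :=
      mul_le_mul_of_nonneg_right (mod_cast hW) hβ0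
    have : 0 ≤ #K * β := by positivity
    linarith
  have hE := mul_le_mul_of_nonneg_right hcoeff
    (sum_nonneg fun w _ => hx0 w : 0 ≤ ∑ w ∈ Kᶜ \ R, x w)
  rw [← sdiff_union_of_subset hRK, sum_mul_nbrSum_union sdiff_disjoint,
    sdiff_union_of_subset hRK]
  linarith

theorem sum_add_le_sum_deviation (hx : ∀ v, 0 ≤ x v) (hK : ∀ u ∈ K, 3 / 4 ≤ x u) (hρ : 0 < ρ)
    (hR : R ⊆ Kᶜ) (hE : ∀ w ∈ Kᶜ \ R, ∃ u ∈ K, ¬ G.Adj w u) :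
    ∑ u ∈ R, (∑ v ∈ K, x v - ρ * x u) ^ 2 / ρ + ∑ w ∈ Kᶜ \ R, (1 / (2 * ρ) + 1 / 2 * x w) ≤
      ∑ w ∈ Kᶜ, ((∑ v ∈ K, x v - ρ * x w) ^ 2 / ρ +
        2 * (x w * (∑ v ∈ K, x v - nbrSum G x K w))) := by
  set s := ∑ v ∈ K, x v
  rw [← sum_sdiff hR, add_comm]
  refine add_le_add (sum_le_sum fun w hw => ?_) (sum_le_sum fun w _ => ?_)
  · obtain ⟨u, hu, huw⟩ := hE w hw
    have hus : nbrSum G x K w + 3 / 4 ≤ s := by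
      have := nbrSum_add_sum_le (G := G) (v := w) (fun u _ => hx u) (singleton_subset_iff.2 hu)
        (by simpa using huw)
      rw [sum_singleton] at this
      linarith [hK u hu]
    have hs : 3 / 4 ≤ s := by
      linarith [nbrSum_nonneg (G := G) (v := w) (S := K) fun u _ => hx u]
    have hmiss : x w * (3 / 4) ≤ x w * (s - nbrSum G x K w) :=
      mul_le_mul_of_nonneg_left (by linarith) (hx w)
    have hdev : 1 / (2 * ρ) ≤ (s - ρ * x w) ^ 2 / ρ + x w := by
      field_simp
      linarith [sq_nonneg (s - ρ * x w - 1 / 2)]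
    linarith
  · have hnonneg : 0 ≤ x w * (s - nbrSum G x K w) :=
      mul_nonneg (hx w) (sub_nonneg.2 (nbrSum_le_sum fun u _ => hx u))
    linarith

theorem IsCore.three_fourths_le (hK : IsCore G x β K) (hβ0 : 0 ≤ β)
    (hβ : 8 * (2 * #K + 3) * β ≤ 1) {u : V} (hu : u ∈ K) : 3 / 4 ≤ x u := by
  have : 0 ≤ #K * β := by positivity
  linarith [hK.one_sub_le u hu]

theorem sum_mul_add_le (hF : F.IsTree) (hd : 3 ≤ F.diam) (hG : F.Free G)
    (hx : IsPerronVector G x) (hW : Fintype.card W ≤ 2 * #K + 3) (hK : IsCore G x β K)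
    (hβ0 : 0 ≤ β) (hβ : 8 * (2 * #K + 3) * β ≤ 1) (hρ : 8 * (#K : ℝ) ^ 2 + 1 < graphRho G)
    (hR : 2 * Fintype.card W ≤ #(commonNbrs G K)) (hle : graphRho (joinGraph K) ≤ graphRho G) :
    ∑ u ∈ K, x u * (∑ v ∈ K, x v - x u - nbrSum G x K u) +
      #(Kᶜ \ commonNbrs G K) / (2 * graphRho G) ≤ 1 / (4 * graphRho G) := by
  have hρ0 : 0 < graphRho G := by nlinarith
  have hKR := isCompleteBetween_commonNbrs (G := G) K
  have hRK : commonNbrs G K ⊆ Kᶜ := fun v hv =>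
    mem_compl.2 (Set.disjoint_right.1 hKR.disjoint hv)
  have hE : ∀ w ∈ Kᶜ \ commonNbrs G K, ∃ u ∈ K, ¬ G.Adj w u := by
    intro w hw
    simpa [mem_commonNbrs, G.adj_comm w] using (mem_sdiff.1 hw).2
  have hs : ∑ v ∈ K, x v ≤ #K := by
    simpa using sum_le_card_nsmul K x 1 fun v _ => hx.le_one v
  have hcomp := sum_deviation_le hx hρ0 hle
  have hgain := sum_add_le_sum_deviation hx.nonneg (fun _ => hK.three_fourths_le hβ0 hβ) hρ0 hRK hE
  have hloss := sum_mul_nbrSum_compl_le hF hd hG hW hKR hR hx.nonneg hK.le_of_notMem hβ0 hβ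
    (sum_nonneg fun v _ => hx.nonneg v) hs hρ
  rw [sum_add_distrib, sum_const, nsmul_eq_mul, mul_one_div, ← mul_sum] at hgain
  linarith

theorem joinGraph_le_of_isCore (hF : F.IsTree) (hd : 3 ≤ F.diam) (hG : F.Free G)
    (hx : IsPerronVector G x) (hW : Fintype.card W ≤ 2 * #K + 3) (hK : IsCore G x β K)
    (hβ0 : 0 ≤ β) (hβ : 8 * (2 * #K + 3) * β ≤ 1) (hρ : 8 * (#K : ℝ) ^ 2 + 1 < graphRho G)
    (hR : 2 * Fintype.card W ≤ #(commonNbrs G K)) (hle : graphRho (joinGraph K) ≤ graphRho G) :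
    joinGraph K ≤ G := by
  have hgain := sum_mul_add_le hF hd hG hx hW hK hβ0 hβ hρ hR hle
  have hρ0 : 0 < graphRho G := by nlinarith
  have hrow : ∀ u ∈ K, ∀ T ⊆ K, (∀ v ∈ T, ¬ G.Adj u v) →
      nbrSum G x K u + ∑ v ∈ T, x v ≤ ∑ v ∈ K, x v := fun u _ T hT hu =>
    nbrSum_add_sum_le (fun v _ => hx.nonneg v) hT hu
  have hterm : ∀ u ∈ K, 0 ≤ x u * (∑ v ∈ K, x v - x u - nbrSum G x K u) := fun u hu => by
    refine mul_nonneg (hx.nonneg u) ?_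
    have := hrow u hu {u} (by simpa using hu) (by simp)
    rw [sum_singleton] at this
    linarith
  have hK34 : ∀ u ∈ K, 3 / 4 ≤ x u := fun _ => hK.three_fourths_le hβ0 hβ
  have hmissing : ∀ u ∈ K, ∀ v, u ≠ v → G.Adj u v := by
    by_contra! hcon
    obtain ⟨u, hu, v, huv, hadj⟩ := hcon
    by_cases hv : v ∈ K
    · have hgap : x v ≤ ∑ w ∈ K, x w - x u - nbrSum G x K u := by
        have := hrow u hu {u, v} (insert_subset hu (singleton_subset_iff.2 hv))
          (by simpa using hadj)
        rw [sum_pair huv] at this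
        linarith
      have hprod : (3 / 4 : ℝ) * (3 / 4) ≤ x u * (∑ w ∈ K, x w - x u - nbrSum G x K u) :=
        mul_le_mul (hK34 u hu) ((hK34 v hv).trans hgap) (by norm_num) (hx.nonneg u)
      have hsum := single_le_sum hterm hu
      have hE : (0 : ℝ) ≤ #(Kᶜ \ commonNbrs G K) / (2 * graphRho G) := by positivity
      have hquarter : 1 / (4 * graphRho G) < 1 / 4 :=
        one_div_lt_one_div_of_lt (by norm_num) (by nlinarith)
      linarith
    · have hvE : v ∈ Kᶜ \ commonNbrs G K :=
        mem_sdiff.2 ⟨mem_compl.2 hv, fun h => hadj (mem_commonNbrs.1 h u hu)⟩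
      have hcard : (1 : ℝ) ≤ #(Kᶜ \ commonNbrs G K) := mod_cast card_pos.2 ⟨v, hvE⟩
      have hE : 1 / (2 * graphRho G) ≤ #(Kᶜ \ commonNbrs G K) / (2 * graphRho G) := by gcongr
      have hquarter : 1 / (4 * graphRho G) < 1 / (2 * graphRho G) := by gcongr; norm_num
      linarith [sum_nonneg hterm]
  rintro u v ⟨huv, hu | hv⟩
  exacts [hmissing u hu v huv, (hmissing v hv u huv.symm).symm]

end Completion

section Isomorphisms

variable {V : Type*} {K K' : Finset V} {a b a' b' : V}

theorem exists_perm_mem_iff (h : #K = #K') : ∃ e : Equiv.Perm V, ∀ v, e v ∈ K' ↔ v ∈ K := by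
  obtain ⟨e, rfl⟩ := Equiv.Perm.exists_map_finset_eq K K' h
  exact ⟨e, by simp⟩

theorem swap_apply_mem_iff (ha : a ∉ K) (hb : b ∉ K) (v : V) : Equiv.swap a b v ∈ K ↔ v ∈ K := by
  rw [Equiv.swap_apply_def]
  split_ifs with hva hvb
  exacts [iff_of_false hb (hva ▸ ha), iff_of_false ha (hvb ▸ hb), Iff.rfl]

theorem exists_perm_mem_iff_apply_eq (h : #K = #K') (ha : a ∉ K) (hb : b ∉ K) (hab : a ≠ b)
    (ha' : a' ∉ K') (hb' : b' ∉ K') (hab' : a' ≠ b') :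
    ∃ e : Equiv.Perm V, (∀ v, e v ∈ K' ↔ v ∈ K) ∧ e a = a' ∧ e b = b' := by
  obtain ⟨e, he⟩ := exists_perm_mem_iff h
  let f := e.trans (Equiv.swap (e a) a')
  have hf : ∀ v, f v ∈ K' ↔ v ∈ K := fun v =>
    (swap_apply_mem_iff (mt (he a).1 ha) ha' _).trans (he v)
  have hfa : f a = a' := Equiv.swap_apply_left _ _
  refine ⟨f.trans (Equiv.swap (f b) b'), fun v => ?_, ?_, Equiv.swap_apply_left _ _⟩
  · exact (swap_apply_mem_iff (mt (hf b).1 hb) hb' _).trans (hf v)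
  · rw [Equiv.trans_apply, hfa, Equiv.swap_apply_of_ne_of_ne _ hab']
    exact hfa ▸ f.injective.ne hab

theorem nonempty_iso_joinGraph (h : #K = #K') : Nonempty (joinGraph K ≃g joinGraph K') := by
  obtain ⟨e, he⟩ := exists_perm_mem_iff h
  exact ⟨⟨e, by simp [joinGraph, he]⟩⟩

theorem nonempty_iso_joinGraph_sup_edge (h : #K = #K') (ha : a ∉ K) (hb : b ∉ K) (hab : a ≠ b)
    (ha' : a' ∉ K') (hb' : b' ∉ K') (hab' : a' ≠ b') :
    Nonempty (joinGraph K ⊔ SimpleGraph.edge a b ≃g joinGraph K' ⊔ SimpleGraph.edge a' b') := by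
  obtain ⟨e, he, rfl, rfl⟩ := exists_perm_mem_iff_apply_eq h ha hb hab ha' hb' hab'
  exact ⟨⟨e, by simp [joinGraph, SimpleGraph.edge_adj, he]⟩⟩

end Isomorphisms

section Structure

variable {V W : Type*} [Fintype V] [Fintype W] {G : SimpleGraph V} {F : SimpleGraph W}
  {K : Finset V}

theorem isCompleteBetween_compl_of_joinGraph_le (h : joinGraph K ≤ G) :
    G.IsCompleteBetween K (Kᶜ : Finset V) := fun _ hu _ hv =>
  h ⟨fun huv => mem_compl.1 (mem_coe.1 hv) (huv ▸ mem_coe.1 hu), Or.inl (mem_coe.1 hu)⟩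

theorem eq_joinGraph_or_of_le (hF : F.IsTree) (hd : 3 ≤ F.diam) (hG : F.Free G)
    (hW : Fintype.card W ≤ 2 * #K + 3) (hK : joinGraph K ≤ G)
    (hn : #K + 2 * Fintype.card W ≤ Fintype.card V) :
    G = joinGraph K ∨
      ∃ a ∉ K, ∃ b ∉ K, a ≠ b ∧ G = joinGraph K ⊔ SimpleGraph.edge a b := by
  have hKR := isCompleteBetween_compl_of_joinGraph_le hK
  have hR : 2 * Fintype.card W ≤ #Kᶜ := by rw [card_compl]; omega
  by_cases! hedge : ∃ a ∉ K, ∃ b ∉ K, G.Adj a b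
  · obtain ⟨a, ha, b, hb, hab⟩ := hedge
    refine Or.inr ⟨a, ha, b, hb, hab.ne, le_antisymm (fun u v huv => ?_)
      (sup_le hK ((SimpleGraph.edge_le_iff _).2 (Or.inr hab)))⟩
    by_cases hu : u ∈ K
    · exact Or.inl ⟨huv.ne, Or.inl hu⟩
    by_cases hv : v ∈ K
    · exact Or.inl ⟨huv.ne, Or.inr hv⟩
    refine Or.inr ((SimpleGraph.edge_adj _ _ _ _).2 ⟨?_, huv.ne⟩)
    exact edge_unique_of_free hF hd hG hW hKR hR hab huv (mem_compl.2 ha) (mem_compl.2 hb)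
      (mem_compl.2 hu) (mem_compl.2 hv)
  · refine Or.inl (le_antisymm (fun u v huv => ⟨huv.ne, ?_⟩) hK)
    by_contra! hcon
    exact hedge u hcon.1 v hcon.2 huv

theorem isContained_joinGraph_sup_edge_of_card_le (hF : F.IsTree) (hd : 3 ≤ F.diam)
    (hW : Fintype.card W ≤ 2 * #K + 2) (hn : #K + 2 * Fintype.card W ≤ Fintype.card V) {a b : V}
    (ha : a ∉ K) (hb : b ∉ K) (hab : a ≠ b) : F ⊑ joinGraph K ⊔ SimpleGraph.edge a b :=
  isContained_of_edge_of_card_le hF hd hW (isCompleteBetween_compl_of_joinGraph_le le_sup_left)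
    (by rw [card_compl]; omega) (Or.inr ((SimpleGraph.edge_adj _ _ _ _).2 ⟨Or.inl ⟨rfl, rfl⟩, hab⟩))
    (mem_compl.2 ha) (mem_compl.2 hb)

theorem isContained_joinGraph_sup_edge_of_odd_diam (hF : F.IsTree) (hd : Odd F.diam)
    (hW : Fintype.card W ≤ 2 * #K + 3) (hn : #K + 2 * Fintype.card W ≤ Fintype.card V) {a b : V}
    (ha : a ∉ K) (hb : b ∉ K) (hab : a ≠ b) : F ⊑ joinGraph K ⊔ SimpleGraph.edge a b :=
  isContained_of_edge_of_odd_diam hF hd hW (isCompleteBetween_compl_of_joinGraph_le le_sup_left)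
    (by rw [card_compl]; omega) (Or.inr ((SimpleGraph.edge_adj _ _ _ _).2 ⟨Or.inl ⟨rfl, rfl⟩, hab⟩))
    (mem_compl.2 ha) (mem_compl.2 hb)

end Structure

section Extremal

open Filter

variable {W : Type*} [Fintype W] {F : SimpleGraph W} {n k : ℕ}

theorem graphS_zero_eq_joinGraph : graphS n k 0 = joinGraph {i : Fin n | (i : ℕ) < k} := by
  ext i j
  simp [graphS, joinGraph]

theorem graphS_one_eq_joinGraph_sup_edge (hkn : k + 2 ≤ n) :
    graphS n k 1 = joinGraph {i : Fin n | (i : ℕ) < k} ⊔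
      SimpleGraph.edge ⟨k, by omega⟩ ⟨k + 1, by omega⟩ := by
  ext i j
  simp [graphS, joinGraph, SimpleGraph.edge_adj, Fin.ext_iff]
  tauto

theorem card_filter_val_lt_of_le (hkn : k ≤ n) : #{i : Fin n | (i : ℕ) < k} = k := by
  rw [Fin.card_filter_val_lt, min_eq_right hkn]

theorem graphRho_graphS_zero_lt_one (hk : 1 ≤ k) (hkn : k + 2 ≤ n) :
    graphRho (graphS n k 0) < graphRho (graphS n k 1) := by
  rw [graphS_one_eq_joinGraph_sup_edge hkn, graphS_zero_eq_joinGraph]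
  refine graphRho_lt_graphRho
    (joinGraph_connected ⟨⟨0, by omega⟩, by simpa using Nat.pos_of_ne_zero (by omega)⟩)
    (SimpleGraph.lt_sup_edge _ _ _ (by simp) (by simp [joinGraph]))

theorem graphRho_joinGraph {K : Finset (Fin n)} (hK : #K = k) :
    graphRho (joinGraph K) = graphRho (graphS n k 0) := by
  have hkn : k ≤ n := by simpa [hK] using card_le_univ K
  obtain ⟨e⟩ := nonempty_iso_joinGraph (hK.trans (card_filter_val_lt_of_le hkn).symm)
  rw [graphRho_congr e, graphS_zero_eq_joinGraph]

omit [Fintype W] in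
theorem SPEX_eq_setOf_iso {G₀ : SimpleGraph (Fin n)} (hfree : F.Free G₀)
    (huniq : ∀ G : SimpleGraph (Fin n), F.Free G → graphRho G₀ ≤ graphRho G →
      Nonempty (G ≃g G₀)) : SPEX n F = {G | Nonempty (G ≃g G₀)} := by
  have hspex : spex n F = graphRho G₀ := by
    refine IsGreatest.csSup_eq ⟨⟨G₀, hfree, rfl⟩, ?_⟩
    rintro _ ⟨G, hG, rfl⟩
    by_contra! hcon
    obtain ⟨e⟩ := huniq G hG hcon.le
    exact hcon.ne (graphRho_congr e).symm
  ext G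
  refine ⟨fun ⟨hG, hρ⟩ => huniq G hG (hspex ▸ hρ.ge), ?_⟩
  rintro ⟨e⟩
  exact ⟨fun h => hfree (h.trans e.isContained), (graphRho_congr e).trans hspex.symm⟩

theorem isContained_graphS_one_of_card_le (hF : F.IsTree) (hd : 3 ≤ F.diam)
    (hW : Fintype.card W ≤ 2 * k + 2) (hn : k + 2 * Fintype.card W + 2 ≤ n) :
    F ⊑ graphS n k 1 := by
  have hcard := card_filter_val_lt_of_le (n := n) (k := k) (by omega)
  rw [graphS_one_eq_joinGraph_sup_edge (by omega)]
  exact isContained_joinGraph_sup_edge_of_card_le hF hd (hcard.symm ▸ hW)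
    (by rw [hcard, Fintype.card_fin]; omega) (by simp) (by simp) (by simp)

theorem isContained_graphS_one_of_odd_diam (hF : F.IsTree) (hd : Odd F.diam)
    (hW : Fintype.card W ≤ 2 * k + 3) (hn : k + 2 * Fintype.card W + 2 ≤ n) :
    F ⊑ graphS n k 1 := by
  have hcard := card_filter_val_lt_of_le (n := n) (k := k) (by omega)
  rw [graphS_one_eq_joinGraph_sup_edge (by omega)]
  exact isContained_joinGraph_sup_edge_of_odd_diam hF hd (hcard.symm ▸ hW)
    (by rw [hcard, Fintype.card_fin]; omega) (by simp) (by simp) (by simp)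

theorem tendsto_sqrt_mul_sub_atTop (hk : 1 ≤ k) :
    Tendsto (fun n : ℕ => √(k * ((n : ℝ) - k))) atTop atTop :=
  Real.tendsto_sqrt_atTop.comp <| Tendsto.const_mul_atTop (by positivity) <|
    tendsto_atTop_add_const_right _ _ tendsto_natCast_atTop_atTop

theorem sqrt_mul_sub_le_graphRho_graphS (hk : 1 ≤ k) (hkn : k < n) :
    √(k * ((n : ℝ) - k)) ≤ graphRho (graphS n k 0) := by
  have hcard := card_filter_val_lt_of_le hkn.le
  have := sqrt_card_mul_sub_le_graphRho_joinGraph (hcard.symm ▸ hk)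
    (by rwa [hcard, Fintype.card_fin])
  rwa [hcard, Fintype.card_fin, ← graphS_zero_eq_joinGraph] at this

theorem eventually_exists_joinGraph_le (hF : F.IsTree) (hd : 3 ≤ F.diam) (hk : 1 ≤ k)
    (hW : Fintype.card W ≤ 2 * k + 3) :
    ∀ᶠ n in atTop, ∀ G : SimpleGraph (Fin n), F.Free G →
      graphRho (graphS n k 0) ≤ graphRho G → ∃ K, #K = k ∧ joinGraph K ≤ G := by
  set β : ℝ := 1 / (8 * (2 * k + 3)) with hβ
  set σ : ℝ := β ^ 2 / 18 / (2 * k + 3) with hσ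
  have hβ0 : 0 < β := by positivity
  have hσ0 : 0 < σ := by positivity
  have hβk : 8 * (2 * k + 3) * β = 1 := by rw [hβ]; field_simp
  have hσk : (2 * k + 3) * σ = β ^ 2 / 18 := by rw [hσ]; field_simp
  have hWk : (Fintype.card W : ℝ) ≤ 2 * k + 3 := mod_cast hW
  have hsqrt := tendsto_sqrt_mul_sub_atTop hk
  filter_upwards [hsqrt.eventually_ge_atTop (2 * Fintype.card W / σ ^ 2),
    hsqrt.eventually_gt_atTop (8 * (k : ℝ) ^ 2 + 1),
    tendsto_natCast_atTop_atTop.eventually_ge_atTop (k ^ 2 / (β ^ 2 / 18)),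
    eventually_ge_atTop (4 * Fintype.card W), eventually_gt_atTop k] with n hnσ hnk hnβ hnW hkn G hG
    hle
  have hκ := (sqrt_mul_sub_le_graphRho_graphS hk hkn).trans hle
  have hκ0 : (0 : ℝ) ≤ k * (n - k) :=
    mul_nonneg k.cast_nonneg (sub_nonneg.2 (mod_cast hkn.le))
  have : Nonempty (Fin n) := ⟨⟨k, hkn⟩⟩
  obtain ⟨x, hx⟩ := exists_isPerronVector G
  obtain ⟨K, rfl, hK⟩ := exists_isCore hF hG hx hk hW hβ0 hβk.le hσ0
    ((mul_le_mul_of_nonneg_right hWk hσ0.le).trans_eq hσk)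
    ((div_le_iff₀' (by positivity)).1 (hnσ.trans hκ))
    (by simpa only [Fintype.card_fin, Real.sq_sqrt hκ0] using
      pow_le_pow_left₀ (Real.sqrt_nonneg _) hκ 2)
    (by simpa using (div_le_iff₀' (by positivity)).1 hnβ) (by rw [Fintype.card_fin]; omega)
  refine ⟨K, rfl, joinGraph_le_of_isCore hF hd hG hx hW hK hβ0.le hβk.le (hnk.trans_le hκ) ?_
    ((graphRho_joinGraph rfl).trans_le hle)⟩
  have hcommon := le_card_commonNbrs K hK.le_card_adj
  have hnW : 4 * (Fintype.card W : ℝ) ≤ n := mod_cast hnW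
  rw [Fintype.card_fin] at hcommon
  have hhalf : 1 / 2 * (n : ℝ) ≤ (1 - #K * β) * n := by gcongr; linarith
  exact_mod_cast (by linarith : 2 * (Fintype.card W : ℝ) ≤ #(commonNbrs G K))

theorem eventually_nonempty_iso_graphS (hF : F.IsTree) (hd : 3 ≤ F.diam) (hk : 1 ≤ k)
    (hW : Fintype.card W ≤ 2 * k + 3) :
    ∀ᶠ n in atTop, ∀ G : SimpleGraph (Fin n), F.Free G →
      graphRho (graphS n k 0) ≤ graphRho G →
        Nonempty (G ≃g graphS n k 0) ∨ Nonempty (G ≃g graphS n k 1) := by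
  filter_upwards [eventually_exists_joinGraph_le hF hd hk hW,
    eventually_ge_atTop (k + 2 * Fintype.card W + 2)] with n hjoin hn G hG hle
  obtain ⟨K, hK, hKG⟩ := hjoin G hG hle
  have hcard := card_filter_val_lt_of_le (n := n) (k := k) (by omega)
  rcases eq_joinGraph_or_of_le hF hd hG (hK ▸ hW) hKG
    (by rw [hK, Fintype.card_fin]; omega) with rfl | ⟨a, ha, b, hb, hab, rfl⟩
  · rw [graphS_zero_eq_joinGraph]
    exact Or.inl (nonempty_iso_joinGraph (hK.trans hcard.symm))
  · rw [graphS_one_eq_joinGraph_sup_edge (by omega)]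
    exact Or.inr (nonempty_iso_joinGraph_sup_edge (hK.trans hcard.symm) ha hb hab (by simp)
      (by simp) (by simp))

theorem eventually_SPEX_eq_graphS_zero (hF : F.IsTree) (hd : 3 ≤ F.diam) (hk : 1 ≤ k)
    (hW : Fintype.card W ≤ 2 * k + 2) (hfree : ∀ᶠ n in atTop, F.Free (graphS n k 0)) :
    ∀ᶠ n in atTop, SPEX n F = {G | Nonempty (G ≃g graphS n k 0)} := by
  filter_upwards [hfree, eventually_nonempty_iso_graphS hF hd hk (by omega),
    eventually_ge_atTop (k + 2 * Fintype.card W + 2)] with n hfree hiso hn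
  refine SPEX_eq_setOf_iso hfree fun G hG hle => (hiso G hG hle).resolve_right ?_
  rintro ⟨e⟩
  exact hG ((isContained_graphS_one_of_card_le hF hd hW hn).trans e.symm.isContained)

theorem eventually_SPEX_eq_graphS_one (hF : F.IsTree) (hd : 3 ≤ F.diam) (hk : 1 ≤ k)
    (hW : Fintype.card W ≤ 2 * k + 3) (hfree : ∀ᶠ n in atTop, F.Free (graphS n k 1)) :
    ∀ᶠ n in atTop, SPEX n F = {G | Nonempty (G ≃g graphS n k 1)} := by
  filter_upwards [hfree, eventually_nonempty_iso_graphS hF hd hk hW,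
    eventually_ge_atTop (k + 2)] with n hfree hiso hn
  have hlt := graphRho_graphS_zero_lt_one hk hn
  refine SPEX_eq_setOf_iso hfree fun G hG hle =>
    (hiso G hG (hlt.le.trans hle)).resolve_left ?_
  rintro ⟨e⟩
  exact (hlt.trans_le hle).ne (graphRho_congr e).symm

theorem eventually_isContained_of_odd_diam (hF : F.IsTree) (hd : 3 ≤ F.diam) (hodd : Odd F.diam)
    (hk : 1 ≤ k) (hW : Fintype.card W ≤ 2 * k + 3) :
    ∀ᶠ n in atTop, ∀ G : SimpleGraph (Fin n), graphRho (graphS n k 0) ≤ graphRho G →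
      ¬ Nonempty (G ≃g graphS n k 0) → F ⊑ G := by
  filter_upwards [eventually_nonempty_iso_graphS hF hd hk hW,
    eventually_ge_atTop (k + 2 * Fintype.card W + 2)] with n hiso hn G hle hne
  by_contra hG
  obtain ⟨e⟩ := (hiso G hG hle).resolve_left hne
  exact hG ((isContained_graphS_one_of_odd_diam hF hodd hW hn).trans e.symm.isContained)

end Extremal

section ParentGraph

variable {V : Type*} {p : V → V} {r : V}

variable (p) in
/-- The graph joining each vertex to its parent under `p`; fixed points of `p` are roots. -/
def parentGraph : SimpleGraph V := SimpleGraph.fromRel fun u v => u = p v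

theorem parentGraph_adj {u v : V} : (parentGraph p).Adj u v ↔ u ≠ v ∧ (u = p v ∨ v = p u) :=
  SimpleGraph.fromRel_adj _ u v

theorem parentGraph_connected [Preorder V] [WellFoundedLT V] (hp : ∀ v ≠ r, p v < v) :
    (parentGraph p).Connected := by
  refine (SimpleGraph.connected_iff_exists_forall_reachable _).2 ⟨r, fun v => ?_⟩
  induction v using WellFoundedLT.induction with
  | _ v ih =>
    rcases eq_or_ne v r with rfl | hv
    · rfl
    · exact (ih _ (hp v hv)).trans (parentGraph_adj.2 ⟨(hp v hv).ne, Or.inl rfl⟩).reachable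

theorem parentGraph_isTree [Preorder V] [Finite V] (hr : p r = r) (hp : ∀ v ≠ r, p v < v) :
    (parentGraph p).IsTree := by
  have := Fintype.ofFinite V
  have hconn := parentGraph_connected hp
  have hedges : (parentGraph p).edgeSet ⊆ ((univ.erase r).image fun v => s(p v, v)) := by
    refine fun e => Sym2.ind (fun u v huv => ?_) e
    obtain ⟨hne, rfl | rfl⟩ := parentGraph_adj.1 ((SimpleGraph.mem_edgeSet _).1 huv)
    · have hv : v ≠ r := by rintro rfl; exact hne hr
      exact mem_coe.2 (mem_image.2 ⟨v, by simpa using hv, rfl⟩)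
    · have hu : u ≠ r := by rintro rfl; exact hne hr.symm
      exact mem_coe.2 (mem_image.2 ⟨u, by simpa using hu, Sym2.eq_swap⟩)
  have hcard : Nat.card (parentGraph p).edgeSet ≤ Fintype.card V - 1 := by
    refine (Nat.card_mono (finite_toSet _) hedges).trans ?_
    rw [Nat.card_coe_set_eq, Set.ncard_coe_finset]
    simpa using card_image_le (s := univ.erase r) (f := fun v => s(p v, v))
  refine SimpleGraph.isTree_iff_connected_and_card.2
    ⟨hconn, le_antisymm ?_ hconn.card_vert_le_card_edgeSet_add_one⟩
  have : 0 < Fintype.card V := Fintype.card_pos_iff.2 ⟨r⟩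
  rw [Nat.card_eq_fintype_card (α := V)]
  omega

end ParentGraph

section Dist

variable {V : Type*} {G : SimpleGraph V}

theorem sub_le_dist_of_forall_adj (hG : G.Connected) {h : V → ℤ}
    (hh : ∀ u v, G.Adj u v → h v - h u ≤ 1) (u v : V) : h v - h u ≤ G.dist u v := by
  obtain ⟨q, hq⟩ := hG.exists_walk_length_eq_dist u v
  rw [← hq]
  clear hq
  induction q with
  | nil => simp
  | cons hadj _ ih =>
    rw [SimpleGraph.Walk.length_cons, Nat.cast_succ]
    linarith [hh _ _ hadj]

end Dist

section Spider

/-- The parent of the vertex `j` of `spider l m`: the vertex `m` ends the first leg, and then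
each two consecutive vertices form a leg. The root `0` is its own parent, since `0 - 1 = 0`. -/
def spiderParent (m j : ℕ) : ℕ := if m < j ∧ (j - m) % 2 = 1 then 0 else j - 1

theorem spiderParent_le (m j : ℕ) : spiderParent m j ≤ j := by
  unfold spiderParent
  split_ifs <;> omega

/-- The tree on `0, …, l - 1` consisting of legs at the vertex `0`: one of length `m`, the others
of length two, except that the last one has length one if the number of vertices requires it. -/
def spider (l m : ℕ) : SimpleGraph (Fin l) :=
  parentGraph fun j => ⟨spiderParent m j, (spiderParent_le m j).trans_lt j.2⟩

variable {l m : ℕ}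

theorem spider_adj {i j : Fin l} : (spider l m).Adj i j ↔
    i ≠ j ∧ ((i : ℕ) = spiderParent m j ∨ (j : ℕ) = spiderParent m i) := by
  simp only [spider, parentGraph_adj, Fin.ext_iff]

theorem spider_isTree (hl : 0 < l) : (spider l m).IsTree := by
  refine parentGraph_isTree (r := ⟨0, hl⟩) (by simp [spiderParent]) fun v hv => ?_
  have hv' : (v : ℕ) ≠ 0 := fun h => hv (Fin.ext h)
  rw [Fin.lt_def]
  dsimp only [spiderParent]
  split_ifs <;> omega

theorem spider_adj_pred {j : ℕ} (hj : j + 1 < l) (h : j < m ∨ (j - m) % 2 = 1) :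
    (spider l m).Adj ⟨j, by omega⟩ ⟨j + 1, hj⟩ := by
  refine spider_adj.2 ⟨by simp, Or.inl ?_⟩
  simp only [spiderParent]
  split_ifs <;> omega

theorem spider_adj_zero {j : ℕ} (hj : j < l) (hmj : m < j) (h : (j - m) % 2 = 1) :
    (spider l m).Adj ⟨0, by omega⟩ ⟨j, hj⟩ :=
  spider_adj.2 ⟨by simp [Fin.ext_iff]; omega, Or.inl (by simp [spiderParent, hmj, h])⟩

theorem spider_dist_le_sub {i j : ℕ} (hij : i ≤ j) (hjm : j ≤ m) (hj : j < l) :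
    (spider l m).dist ⟨i, by omega⟩ ⟨j, hj⟩ ≤ j - i := by
  induction j, hij using Nat.le_induction with
  | base => simp
  | succ j hij ih =>
    have hadj := spider_adj_pred (m := m) hj (by omega)
    have := (spider_isTree (m := m) (by omega)).connected.dist_triangle
      (u := ⟨i, by omega⟩) (v := ⟨j, by omega⟩) (w := ⟨j + 1, hj⟩)
    rw [SimpleGraph.dist_eq_one_iff_adj.2 hadj] at this
    have := ih (by omega) (by omega)
    omega

theorem spider_dist_zero_le_two {j : ℕ} (hmj : m < j) (hj : j < l) :
    (spider l m).dist ⟨0, by omega⟩ ⟨j, hj⟩ ≤ 2 := by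
  rcases Nat.mod_two_eq_zero_or_one (j - m) with h | h
  · obtain ⟨j, rfl⟩ : ∃ i, j = i + 1 := ⟨j - 1, by omega⟩
    have h₁ := spider_adj_zero (l := l) (m := m) (j := j) (by omega) (by omega) (by omega)
    have h₂ := spider_adj_pred (m := m) hj (by omega)
    exact (SimpleGraph.dist_le (h₁.toWalk.append h₂.toWalk)).trans (by simp)
  · exact (SimpleGraph.dist_eq_one_iff_adj.2 (spider_adj_zero hj hmj h)).trans_le one_le_two

theorem spider_dist_le (hm : 2 ≤ m) (i j : Fin l) : (spider l m).dist i j ≤ m + 2 := by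
  wlog hij : (i : ℕ) ≤ j generalizing i j
  · rw [SimpleGraph.dist_comm]
    exact this j i (by omega)
  obtain ⟨i, hi⟩ := i
  obtain ⟨j, hj⟩ := j
  rcases le_or_gt j m with hjm | hjm
  · exact (spider_dist_le_sub hij hjm hj).trans (by dsimp only; omega)
  have hi0 : (spider l m).dist ⟨i, hi⟩ ⟨0, by omega⟩ ≤ m := by
    rw [SimpleGraph.dist_comm]
    rcases le_or_gt i m with him | him
    · exact (spider_dist_le_sub (Nat.zero_le i) him hi).trans (by omega)
    · exact (spider_dist_zero_le_two him hi).trans hm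
  exact (spider_isTree (by omega)).connected.dist_triangle.trans
    (add_le_add hi0 (spider_dist_zero_le_two hjm hj))

theorem le_spider_dist (hl : m + 3 ≤ l) :
    m + 2 ≤ (spider l m).dist ⟨m + 2, by omega⟩ ⟨m, by omega⟩ := by
  -- the signed distance from `0`, negative on all legs but the first
  have h := sub_le_dist_of_forall_adj (spider_isTree (l := l) (m := m) (by omega)).connected
    (h := fun j => if (j : ℕ) ≤ m then (j : ℤ) else if ((j : ℕ) - m) % 2 = 1 then -1 else -2)
    (fun u v huv => ?_) ⟨m + 2, by omega⟩ ⟨m, by omega⟩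
  · simp at h
    omega
  · have := spider_adj.1 huv
    simp only [spiderParent, ne_eq, Fin.ext_iff] at this
    split_ifs at this ⊢ <;> omega

theorem spider_diam (hm : 2 ≤ m) (hl : m + 3 ≤ l) : (spider l m).diam = m + 2 := by
  have : Nonempty (Fin l) := ⟨⟨0, by omega⟩⟩
  refine le_antisymm ?_ ((le_spider_dist hl).trans (SimpleGraph.dist_le_diam
    (SimpleGraph.connected_iff_ediam_ne_top.1 (spider_isTree (by omega)).connected)))
  obtain ⟨u, v, huv⟩ := (spider l m).exists_dist_eq_diam
  exact huv ▸ spider_dist_le hm u v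

end Spider

section VertexCover

variable {V W : Type*} [Finite W] {F : SimpleGraph W} {K : Finset V}

theorem exists_isVertexCover_of_isContained_joinGraph (hF : F ⊑ joinGraph K) :
    ∃ C : Finset W, #C ≤ #K ∧ F.IsVertexCover C := by
  have := Fintype.ofFinite W
  obtain ⟨f⟩ := hF
  refine ⟨({w | f w ∈ K} : Finset W), card_le_card_of_injOn f (fun w hw => by simpa using hw)
    f.injective.injOn, fun u v huv => ?_⟩
  simpa using (f.toHom.map_adj huv).2

theorem exists_isVertexCover_of_isContained_joinGraph_sup_edge {a b : V}
    (hF : F ⊑ joinGraph K ⊔ SimpleGraph.edge a b) :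
    ∃ C : Finset W, #C ≤ #K ∧ (F.IsVertexCover C ∨ ∃ u v, F.Adj u v ∧
      F.IsVertexCover (insert u (C : Set W)) ∧ F.IsVertexCover (insert v (C : Set W))) := by
  have := Fintype.ofFinite W
  obtain ⟨f⟩ := hF
  refine ⟨({w | f w ∈ K} : Finset W), card_le_card_of_injOn f (fun w hw => by simpa using hw)
    f.injective.injOn, or_iff_not_imp_left.2 fun hC => ?_⟩
  have hf : Function.Injective f := f.injective
  obtain ⟨u, v, huv, hu, hv⟩ : ∃ u v, F.Adj u v ∧ f u ∉ K ∧ f v ∉ K := by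
    simpa [SimpleGraph.IsVertexCover] using hC
  have hedge : ∀ ⦃x y⦄, F.Adj x y → (f x ∈ K ∨ f y ∈ K) ∨ s(f x, f y) = s(a, b) := by
    intro x y hxy
    rcases f.toHom.map_adj hxy with h | h
    · exact Or.inl h.2
    · exact Or.inr (Sym2.eq_iff.2 ((SimpleGraph.edge_adj ..).1 h).1)
  have huv' := (hedge huv).resolve_left (by tauto)
  have hcover : ∀ ⦃x y⦄, F.Adj x y →
      (f x ∈ K ∨ f y ∈ K) ∨ (x = u ∧ y = v ∨ x = v ∧ y = u) := by
    intro x y hxy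
    refine (hedge hxy).imp_right fun h => ?_
    simpa only [Sym2.eq_iff, hf.eq_iff] using h.trans huv'.symm
  refine ⟨u, v, huv, fun x y hxy => ?_, fun x y hxy => ?_⟩ <;>
  · have := hcover hxy
    simp only [Set.mem_insert_iff, mem_coe, mem_filter, mem_univ, true_and]
    tauto

end VertexCover

section SpiderCovers

variable {l m n k : ℕ} {C : Finset (Fin l)}

theorem div_two_le_card_of_isVertexCover (hm : Odd m) (hC : (spider l m).IsVertexCover C) :
    l / 2 ≤ #C := by
  rw [Nat.odd_iff] at hm
  have hsurj : Set.SurjOn (fun v : Fin l => (v : ℕ) / 2) C (range (l / 2)) := by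
    intro i hi
    have hi : i < l / 2 := by simpa using hi
    rcases hC (spider_adj_pred (l := l) (m := m) (j := 2 * i) (by omega) (by omega)) with h | h
    · exact ⟨_, h, by dsimp only; omega⟩
    · exact ⟨_, h, by dsimp only; omega⟩
  simpa using card_le_card_of_surjOn _ hsurj

theorem exists_mem_of_isVertexCover (hm : Even m) (hC : (spider l m).IsVertexCover C) {i : ℕ}
    (hi : 2 * i + 2 < l) : ∃ v ∈ C, (v : ℕ) = 2 * i + 1 ∨ (v : ℕ) = 2 * i + 2 := by
  rw [Nat.even_iff] at hm
  rcases hC (spider_adj_pred (l := l) (m := m) (j := 2 * i + 1) hi (by omega)) with h | h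
  · exact ⟨_, h, Or.inl rfl⟩
  · exact ⟨_, h, Or.inr rfl⟩

theorem lt_card_of_isVertexCover {C : Finset (Fin (2 * k + 2))} (hm : Even m)
    (hml : m < 2 * k + 1) (hC : (spider (2 * k + 2) m).IsVertexCover C) : k < #C := by
  have hsurj : Set.SurjOn (fun v : Fin (2 * k + 2) => ((v : ℕ) + 1) / 2 % (k + 1)) C
      (range (k + 1)) := by
    intro i hi
    have hi : i < k + 1 := by simpa using hi
    rcases i with - | i
    · rcases hC (spider_adj_zero (j := 2 * k + 1) (by omega) hml
        (by rw [Nat.even_iff] at hm; omega)) with h | h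
      · exact ⟨_, h, by simp⟩
      · exact ⟨_, h, by simp [show (2 * k + 1 + 1) / 2 = k + 1 by omega]⟩
    · obtain ⟨v, hv, hvi⟩ := exists_mem_of_isVertexCover hm hC (i := i) (by omega)
      exact ⟨v, hv, by
        dsimp only
        rw [show ((v : ℕ) + 1) / 2 = i + 1 by omega, Nat.mod_eq_of_lt hi]⟩
  simpa using card_le_card_of_surjOn _ hsurj

theorem spider_exists_even_adj (hm : Even m) {j : ℕ} (hj : 2 * j + 1 < l) :
    ∃ i, ∃ _ : i ≤ j, (spider l m).Adj ⟨2 * i, by omega⟩ ⟨2 * j + 1, hj⟩ := by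
  rw [Nat.even_iff] at hm
  rcases lt_or_ge m (2 * j + 1) with h | h
  · exact ⟨0, j.zero_le, spider_adj_zero hj h (by omega)⟩
  · exact ⟨j, le_rfl, spider_adj_pred hj (by omega)⟩

theorem odd_of_mem_of_isVertexCover {C : Finset (Fin (2 * k + 3))} (hm : Even m)
    (hC : (spider (2 * k + 3) m).IsVertexCover C) (hk : #C ≤ k + 1) :
    ∀ v ∈ C, Odd (v : ℕ) := by
  -- `C` contains exactly one endpoint of each edge `{2i + 1, 2i + 2}`, and nothing else
  have hsub : Icc 1 (k + 1) ⊆ C.image fun v : Fin (2 * k + 3) => ((v : ℕ) + 1) / 2 := by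
    intro i hi
    rw [mem_Icc] at hi
    obtain ⟨v, hv, hvi⟩ := exists_mem_of_isVertexCover hm hC (i := i - 1) (by omega)
    exact mem_image.2 ⟨v, hv, by omega⟩
  have himage := eq_of_subset_of_card_le hsub (card_image_le.trans (by simpa using hk))
  have hinj : Set.InjOn (fun v : Fin (2 * k + 3) => ((v : ℕ) + 1) / 2) C :=
    card_image_iff.1 (le_antisymm card_image_le (by rw [← himage]; simpa using hk))
  have hpos : ∀ v ∈ C, 1 ≤ ((v : ℕ) + 1) / 2 := fun v hv =>
    (mem_Icc.1 (himage ▸ mem_image_of_mem _ hv)).1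
  have heven : ∀ j, ∀ hj : 2 * j < 2 * k + 3, (⟨2 * j, hj⟩ : Fin _) ∉ C := by
    intro j
    induction j using Nat.strong_induction_on with
    | _ j ih =>
      intro hj hjC
      rcases j with - | j
      · simpa using hpos _ hjC
      obtain ⟨i, hi, hadj⟩ := spider_exists_even_adj (l := 2 * k + 3) hm (j := j) (by omega)
      have hmem := (hC hadj).resolve_left (ih i (by omega) _)
      have := hinj hmem hjC (by dsimp only; omega)
      simp only [Fin.mk.injEq] at this
      omega
  intro v hv
  by_contra hodd
  obtain ⟨j, hj⟩ := (Nat.not_odd_iff_even.1 hodd).two_dvd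
  exact heven j (hj ▸ v.2) (by convert hv; exact hj.symm)

theorem spider_even_of_adj (hm : Even m) {u v : Fin l} (h : (spider l m).Adj u v) :
    Even (u : ℕ) ∨ Even (v : ℕ) := by
  have := spider_adj.1 h
  simp only [ne_eq, Fin.ext_iff, spiderParent] at this
  simp only [Nat.even_iff] at hm ⊢
  split_ifs at this <;> omega

theorem spider_free_graphS_zero_of_odd (hm : Odd m) (hl : 2 * k + 2 ≤ l) (hkn : k ≤ n) :
    (spider l m).Free (graphS n k 0) := by
  rw [graphS_zero_eq_joinGraph]
  intro h
  obtain ⟨C, hCk, hC⟩ := exists_isVertexCover_of_isContained_joinGraph h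
  rw [card_filter_val_lt_of_le hkn] at hCk
  have := div_two_le_card_of_isVertexCover hm hC
  omega

theorem spider_free_graphS_zero_of_even (hm : Even m) (hml : m < 2 * k + 1) (hkn : k ≤ n) :
    (spider (2 * k + 2) m).Free (graphS n k 0) := by
  rw [graphS_zero_eq_joinGraph]
  intro h
  obtain ⟨C, hCk, hC⟩ := exists_isVertexCover_of_isContained_joinGraph h
  rw [card_filter_val_lt_of_le hkn] at hCk
  exact (lt_card_of_isVertexCover hm hml hC).not_ge hCk

theorem spider_free_graphS_one (hm : Even m) (hkn : k + 2 ≤ n) :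
    (spider (2 * k + 3) m).Free (graphS n k 1) := by
  rw [graphS_one_eq_joinGraph_sup_edge hkn]
  intro h
  obtain ⟨C, hCk, hC⟩ := exists_isVertexCover_of_isContained_joinGraph_sup_edge h
  rw [card_filter_val_lt_of_le (by omega)] at hCk
  obtain ⟨u, hu, hCu⟩ : ∃ u : Fin (2 * k + 3), Even (u : ℕ) ∧
      (spider (2 * k + 3) m).IsVertexCover (insert u (C : Set _)) := by
    rcases hC with hC | ⟨u, v, huv, hCu, hCv⟩
    · exact ⟨0, Even.zero, hC.subset (Set.subset_insert _ _)⟩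
    · rcases spider_even_of_adj hm huv with hu | hv
      · exact ⟨u, hu, hCu⟩
      · exact ⟨v, hv, hCv⟩
  rw [← coe_insert] at hCu
  exact Nat.not_odd_iff_even.2 hu (odd_of_mem_of_isVertexCover hm hCu
    ((card_insert_le _ _).trans (by omega)) u (mem_insert_self u C))

end SpiderCovers

section Theorem

open Filter

variable {l d : ℕ}

theorem eventually_SPEX_spider (hl : 6 ≤ l) (hd4 : 4 ≤ d) (hdl : d + 1 ≤ l)
    (hpar : Even l ∨ Even d) :
    ∀ᶠ n in atTop, SPEX n (spider l (d - 2)) = {G | Nonempty (G ≃g graphGnl n l)} := by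
  have hF : (spider l (d - 2)).IsTree := spider_isTree (by omega)
  have hd : 3 ≤ (spider l (d - 2)).diam := by rw [spider_diam] <;> omega
  rcases Nat.even_or_odd l with hle | hlo
  · obtain ⟨k, rfl⟩ : ∃ k, l = 2 * k + 2 := ⟨(l - 2) / 2, by rw [Nat.even_iff] at hle; omega⟩
    simp only [graphGnl, if_pos hle, Nat.add_sub_cancel, Nat.mul_div_cancel_left k two_pos]
    refine eventually_SPEX_eq_graphS_zero hF hd (by omega) (by simp) ?_
    filter_upwards [eventually_ge_atTop k] with n hn
    rcases Nat.even_or_odd (d - 2) with hm | hm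
    · exact spider_free_graphS_zero_of_even hm (by omega) hn
    · exact spider_free_graphS_zero_of_odd hm le_rfl hn
  · obtain ⟨k, rfl⟩ : ∃ k, l = 2 * k + 3 := ⟨(l - 3) / 2, by rw [Nat.odd_iff] at hlo; omega⟩
    have hl := Nat.not_even_iff_odd.2 hlo
    have hm : Even (d - 2) := (hpar.resolve_left hl).tsub even_two
    simp only [graphGnl, if_neg hl, Nat.add_sub_cancel, Nat.mul_div_cancel_left k two_pos]
    refine eventually_SPEX_eq_graphS_one hF hd (by omega) (by simp) ?_
    filter_upwards [eventually_ge_atTop (k + 2)] with n hn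
    exact spider_free_graphS_one hm hn

theorem eventually_forall_isContained_iff (hl : Odd l) (hd : Odd d) (hd4 : 4 ≤ d)
    (hdl : d + 1 ≤ l) :
    ∀ᶠ n in atTop, ∀ G : SimpleGraph (Fin n),
      graphRho (graphS n ((l - 3) / 2) 0) ≤ graphRho G →
        ((∀ F : SimpleGraph (Fin l), F.IsTree → F.diam = d → F ⊑ G) ↔
          ¬ Nonempty (G ≃g graphS n ((l - 3) / 2) 0)) := by
  obtain ⟨k, rfl⟩ : ∃ k, l = 2 * k + 3 := ⟨(l - 3) / 2, by rw [Nat.odd_iff] at hl; omega⟩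
  simp only [Nat.add_sub_cancel, Nat.mul_div_cancel_left k two_pos]
  have hall : ∀ᶠ n in atTop, ∀ F : SimpleGraph (Fin (2 * k + 3)), F.IsTree → F.diam = d →
      ∀ G : SimpleGraph (Fin n), graphRho (graphS n k 0) ≤ graphRho G →
        ¬ Nonempty (G ≃g graphS n k 0) → F ⊑ G := by
    simp only [eventually_all]
    intro F hF hFd
    exact eventually_isContained_of_odd_diam hF (by omega) (hFd ▸ hd) (by omega) (by simp)
  filter_upwards [hall, eventually_ge_atTop k] with n hall hn G hle
  refine ⟨fun h ⟨e⟩ => ?_, fun hne F hF hFd => hall F hF hFd G hle hne⟩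
  have hm : Odd (d - 2) := Nat.Odd.sub_even (by omega) hd even_two
  exact spider_free_graphS_zero_of_odd hm (by omega) hn
    ((h _ (spider_isTree (by omega)) (by rw [spider_diam] <;> omega)).trans e.isContained)

end Theorem

end SpectralTrees

theorem theorem1p2 (l d : ℕ) (hl : 6 ≤ l) (hd4 : 4 ≤ d) (hdl : d ≤ l - 1) :
    ∃ N : ℕ,
      ((Even l ∨ Even d) →
        ∃ F : SimpleGraph (Fin l), F.IsTree ∧ F.diam = d ∧
          ∀ n : ℕ, N ≤ n →
            SPEX n F = {G : SimpleGraph (Fin n) | Nonempty (G ≃g graphGnl n l)}) ∧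
      ((Odd l ∧ Odd d) →
        ∀ n : ℕ, N ≤ n → ∀ G : SimpleGraph (Fin n),
          graphRho (graphS n ((l - 3) / 2) 0) ≤ graphRho G →
            ((∀ F : SimpleGraph (Fin l), F.IsTree → F.diam = d → F ⊑ G) ↔
              ¬ Nonempty (G ≃g graphS n ((l - 3) / 2) 0))) := by
  have hdl' : d + 1 ≤ l := by omega
  by_cases hpar : Even l ∨ Even d
  · obtain ⟨N, hN⟩ := Filter.eventually_atTop.1 (eventually_SPEX_spider hl hd4 hdl' hpar)
    refine ⟨N, fun _ => ⟨spider l (d - 2), spider_isTree (by omega),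
      by rw [spider_diam] <;> omega, hN⟩, fun hodd => absurd hpar ?_⟩
    simpa only [not_or, Nat.not_even_iff_odd] using hodd
  · have hodd : Odd l ∧ Odd d := by simpa only [not_or, Nat.not_even_iff_odd] using hpar
    obtain ⟨N, hN⟩ := Filter.eventually_atTop.1
      (eventually_forall_isContained_iff hodd.1 hodd.2 hd4 hdl')
    exact ⟨N, fun h => absurd h hpar, fun _ => hN⟩
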